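/- Let $k$ be a field, $P=k[x_1,\dots,x_n]$, and let $I\subseteq P$ be a homogeneous ideal. Leading terms are taken with respect to the degree reverse lexicographic order with $x_1\succ x_2\succ\cdots\succ x_n$, and $\operatorname{lt} I$ denotes the monomial ideal generated by the leading terms of the nonzero elements of $I$. For a term $t\neq 1$ let $m(t)$ be the largest index of a variable dividing $t$, and put $m(1)=1$. A monomial ideal $J$, with $d$ the maximal degree of a minimal generator of $J$, is quasi-stable if for every term $x^\mu\in J$ and every $j<m=m(x^\mu)$ the term $x_j^{d}\,x^\mu/x_m^{\mu_m}$ lies in $J$; the ideal $I$ is in quasi-stable position if $\operatorname{lt} I$ is quasi-stable. A matrix $A=(a_{ij})\in \mathrm{GL}(n,k)$ acts on $P$ by $x_i\mapsto\sum_j a_{ij}x_j$, and $A\cdot I$ is the image of $I$. For $q\ge 0$ let $$\beta_q(I)=\bigl(\beta_q^{(1)}(I),\dots,\beta_q^{(n)}(I)\bigr),\qquad \beta_q^{(i)}(I)=\#\{t \text{ a term of degree } q : t\in \operatorname{lt} I,\ m(t)=i\}.$$ Vectors are compared lexicographically, the first entry being the most significant. The ideal $I$ is in $\beta$-maximal position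 if $\beta_q(I)\succeq_{\mathrm{lex}}\beta_q(A\cdot I)$ for all $A\in \mathrm{GL}(n,k)$ and all $q\ge 0$ with $I_q\ne 0$. For a homogeneous ideal $J$ let $\operatorname{reg} J=\max\{j : \operatorname{Tor}_i^P(J,k)_{i+j}\neq 0 \text{ for some } i\}$ be its Castelnuovo–Mumford regularity (with $\operatorname{reg} 0=0$). 1. If $I$ is in quasi-stable position, then $\beta_q(I)\succeq_{\mathrm{lex}}\beta_q(A\cdot I)$ for all $A\in \mathrm{GL}(n,k)$ and all $q\ge \operatorname{reg}(\operatorname{lt} I)$. 2. If $k$ is infinite, then $I$ is in quasi-stable position if and only if $\beta_q(I)\succeq_{\mathrm{lex}}\beta_q(A\cdot I)$ for all $A\in \mathrm{GL}(n,k)$ and all $q\ge \operatorname{reg}(\operatorname{lt} I)$. 3. If $k$ is infinite and $I$ is in $\beta$-maximal position, then $I$ is in quasi-stable position. -/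

import Mathlib

noncomputable section

namespace StablePosition

open MvPolynomial

/-! ### The degree reverse lexicographic order -/

/-- Exponent vectors in `n` variables, to be ordered degree reverse lexicographically. -/
def DegRevLex (n : ℕ) : Type := Fin n →₀ ℕ

instance (n : ℕ) : AddCommMonoid (DegRevLex n) :=
  inferInstanceAs (AddCommMonoid (Fin n →₀ ℕ))

/-- First compare total degrees; for equal degrees, the vector with the larger entry at the last
index where the two differ is the smaller one. -/
def degRevLexKey {n : ℕ} (a : DegRevLex n) : ℕ ×ₗ (Colex (Fin n →₀ ℕ))ᵒᵈ :=
  toLex (Finsupp.degree (show Fin n →₀ ℕ from a),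
    OrderDual.toDual (toColex (show Fin n →₀ ℕ from a)))

theorem degRevLexKey_injective {n : ℕ} :
    Function.Injective (degRevLexKey : DegRevLex n → _) := by
  intro a b h
  exact congrArg (fun p => ofColex (OrderDual.ofDual (ofLex p).2)) h

instance (n : ℕ) : LinearOrder (DegRevLex n) :=
  LinearOrder.lift' degRevLexKey degRevLexKey_injective

theorem degRevLex_le_iff_key {n : ℕ} {a b : DegRevLex n} :
    a ≤ b ↔ degRevLexKey a ≤ degRevLexKey b := Iff.rfl

theorem degRevLex_lt_iff_key {n : ℕ} {a b : DegRevLex n} :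
    a < b ↔ degRevLexKey a < degRevLexKey b := Iff.rfl

theorem degRevLexKey_add {n : ℕ} (a b : DegRevLex n) :
    degRevLexKey (a + b) =
      toLex (Finsupp.degree (show Fin n →₀ ℕ from a) + Finsupp.degree (show Fin n →₀ ℕ from b),
        OrderDual.toDual (toColex (show Fin n →₀ ℕ from a) +
          toColex (show Fin n →₀ ℕ from b))) := by
  have : Finsupp.degree ((show Fin n →₀ ℕ from a) + (show Fin n →₀ ℕ from b)) = _ :=
    map_add Finsupp.degree _ _
  rw [← this]
  rfl

instance (n : ℕ) : IsOrderedAddMonoid (DegRevLex n) where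
  add_le_add_left a b h c := by
    rw [degRevLex_le_iff_key] at h ⊢
    rw [degRevLexKey_add, degRevLexKey_add]
    simp only [degRevLexKey, Prod.Lex.toLex_le_toLex, OrderDual.toDual_le_toDual] at h ⊢
    simpa using h

theorem degRevLex_monotone {n : ℕ} :
    Monotone (fun a : Fin n →₀ ℕ => (show DegRevLex n from a)) := by
  intro a b h
  change degRevLexKey (n := n) a ≤ degRevLexKey (n := n) b
  simp only [degRevLexKey, Prod.Lex.toLex_le_toLex]
  rcases (Finsupp.degree_mono h).lt_or_eq with h1 | h1
  · exact Or.inl h1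
  · refine Or.inr ⟨h1, ?_⟩
    have : a = b := by
      rw [← add_tsub_cancel_of_le h, map_add] at h1
      have h2 : (b - a).degree = 0 := by omega
      rw [Finsupp.degree_eq_zero_iff] at h2
      rw [← add_tsub_cancel_of_le h, h2, add_zero]
    rw [this]

instance (n : ℕ) : WellFoundedLT (DegRevLex n) := by
  constructor
  rw [RelEmbedding.wellFounded_iff_isEmpty]
  refine ⟨fun f => ?_⟩
  obtain ⟨i, j, hij, h⟩ := Finsupp.wellQuasiOrderedLE.wqo f
  exact absurd (f.map_rel_iff.2 hij) (not_lt.2 (degRevLex_monotone h))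

/-- The degree reverse lexicographic term order with `x₁ ≻ x₂ ≻ ⋯ ≻ xₙ`
(the variable `xᵢ₊₁` is `X i`, `i : Fin n`). -/
def degRevLex (n : ℕ) : MonomialOrder (Fin n) where
  syn := DegRevLex n
  toSyn := { toEquiv := (Equiv.refl _ : (Fin n →₀ ℕ) ≃ DegRevLex n), map_add' := fun _ _ => rfl }
  toSyn_monotone := degRevLex_monotone

open scoped MonomialOrder in
theorem degRevLex_lt_iff {n : ℕ} {a b : Fin n →₀ ℕ} :
    a ≺[degRevLex n] b ↔ a.degree < b.degree ∨
      (a.degree = b.degree ∧ ∃ i, (∀ j, i < j → b j = a j) ∧ b i < a i) := by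
  change degRevLexKey (n := n) a < degRevLexKey (n := n) b ↔ _
  simp only [degRevLexKey, Prod.Lex.toLex_lt_toLex]
  rfl

/-! ### Leading ideals, coordinate changes, quasi-stability -/

section

variable {k : Type*} [Field k] {n : ℕ}

/-- The leading ideal `lt I`: the monomial ideal generated by the leading terms of the nonzero
elements of `I`. -/
def leadingIdeal (m : MonomialOrder (Fin n)) (I : Ideal (MvPolynomial (Fin n) k)) :
    Ideal (MvPolynomial (Fin n) k) :=
  Ideal.span {t | ∃ f ∈ I, f ≠ 0 ∧ t = monomial (m.degree f) 1}

/-- The linear coordinate change `xᵢ ↦ ∑ⱼ aᵢⱼ xⱼ`. -/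
def coordChange (A : Matrix.GeneralLinearGroup (Fin n) k) :
    MvPolynomial (Fin n) k →ₐ[k] MvPolynomial (Fin n) k :=
  aeval fun i => ∑ j, C ((A : Matrix (Fin n) (Fin n) k) i j) * X j

/-- The transformed ideal `A · I`. -/
def transform (A : Matrix.GeneralLinearGroup (Fin n) k) (I : Ideal (MvPolynomial (Fin n) k)) :
    Ideal (MvPolynomial (Fin n) k) :=
  I.map (coordChange A)

/-- The largest index of a variable occurring in `x^μ`, counted from `0`. For the term `1` it is
the first index. -/
def maxVar (μ : Fin n →₀ ℕ) : ℕ := μ.support.sup fun i => (i : ℕ)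

/-- The maximal degree of a minimal generator of the monomial ideal `J`
(`0` if there is no generator). The minimal generators are the terms in `J` that are minimal
with respect to divisibility. -/
def maxGenDegree (J : Ideal (MvPolynomial (Fin n) k)) : ℕ :=
  sSup {d | ∃ μ : Fin n →₀ ℕ, Minimal (fun ν => monomial ν (1 : k) ∈ J) μ ∧ μ.degree = d}

/-- A monomial ideal `J` is quasi-stable if for every term `x^μ ∈ J` with largest variable `x_m`
and every `j < m`, the term `x_j^q x^μ / x_m^{μ_m}` is in `J`, where `q` is the maximal degree of
a minimal generator. -/
def IsQuasiStable (J : Ideal (MvPolynomial (Fin n) k)) : Prop :=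
  ∀ μ : Fin n →₀ ℕ, monomial μ (1 : k) ∈ J → ∀ j m : Fin n, (m : ℕ) = maxVar μ → j < m →
    monomial (μ.erase m + Finsupp.single j (maxGenDegree J)) (1 : k) ∈ J

/-- `I` is in quasi-stable position: its leading ideal is quasi-stable. -/
def InQuasiStablePosition (m : MonomialOrder (Fin n)) (I : Ideal (MvPolynomial (Fin n) k)) :
    Prop :=
  IsQuasiStable (leadingIdeal m I)

/-! ### β-vectors -/

/-- The `β`-vector of `I` at degree `q`: its `i`-th entry is the number of terms of degree `q` in
`lt I` whose largest variable is `X i`. -/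
def betaVector (m : MonomialOrder (Fin n)) (I : Ideal (MvPolynomial (Fin n) k)) (q : ℕ) :
    Fin n → ℕ :=
  fun i => Set.ncard {μ : Fin n →₀ ℕ |
    μ.degree = q ∧ monomial μ (1 : k) ∈ leadingIdeal m I ∧ maxVar μ = i}

/-- `I` is in `β`-maximal position: `β_q(I) ⪰_lex β_q(A · I)` for all invertible `A` and all
degrees `q` with `I_q ≠ 0`. -/
def InBetaMaximalPosition (m : MonomialOrder (Fin n)) (I : Ideal (MvPolynomial (Fin n) k)) :
    Prop :=
  ∀ (A : Matrix.GeneralLinearGroup (Fin n) k) (q : ℕ),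
    (∃ f ∈ I, f ≠ 0 ∧ f.IsHomogeneous q) →
      toLex (betaVector m (transform A I) q) ≤ toLex (betaVector m I q)

/-! ### Castelnuovo–Mumford regularity

`Tor_i(J, k)` is computed by tensoring `J` with the Koszul complex, which is the minimal graded
free resolution of `k` over the polynomial ring. An element `∑_S e_S ⊗ c_S` of `Λ^i k^n ⊗ J` is
encoded as the family `S ↦ c_S`, supported on the `i`-element sets `S`; as `e_S` has degree `i`,
its degree `i + j` part is `Λ^i k^n ⊗ J_j`. -/

/-- The elements of the `i`-th module `Λ^i k^n ⊗ J` of the Koszul complex of `J`. -/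
def koszulChains (J : Ideal (MvPolynomial (Fin n) k)) (i : ℕ) :
    Set (Finset (Fin n) → MvPolynomial (Fin n) k) :=
  {c | (∀ S, c S ∈ J) ∧ ∀ S, S.card ≠ i → c S = 0}

/-- The Koszul differential `e_S ↦ ∑_{l ∈ S} (-1)^{#{s ∈ S | s < l}} x_l e_{S \ {l}}`, read off at
the coefficient of `e_T`, where `S = T ∪ {l}`. -/
def koszulDifferential (c : Finset (Fin n) → MvPolynomial (Fin n) k) :
    Finset (Fin n) → MvPolynomial (Fin n) k :=
  fun T => ∑ l ∈ Tᶜ, (-1) ^ (T.filter (· < l)).card * (X l * c (insert l T))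

/-- `Tor_i(J, k)_{i+j} ≠ 0` for a homogeneous ideal `J`: some Koszul cycle in `Λ^i k^n ⊗ J_j` is
not a boundary. -/
def TorNonzero (J : Ideal (MvPolynomial (Fin n) k)) (i j : ℕ) : Prop :=
  ∃ c ∈ koszulChains J i, (∀ S, (c S).IsHomogeneous j) ∧ koszulDifferential c = 0 ∧
    ¬ ∃ b ∈ koszulChains J (i + 1), koszulDifferential b = c

/-- The Castelnuovo–Mumford regularity of a homogeneous ideal `J`, i.e. the largest `j` such that
`Tor_i(J, k)_{i+j} ≠ 0` for some `i` (and `0` for `J = 0`). -/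
def regularity (J : Ideal (MvPolynomial (Fin n) k)) : ℕ∞ :=
  ⨆ (i : ℕ) (j : ℕ) (_ : TorNonzero J i j), (j : ℕ∞)

end

end StablePosition

end

open StablePosition

attribute [local instance] MvPolynomial.gradedAlgebra

/-! The key operation is dividing a term by its largest variable. Let U be the set of exponents of
lt I. Multiplication by x_i embeds the terms of U of degree q with largest variable at most x_i into
those of degree q + 1 with largest variable x_i. Hence β_{q+1}^{(i)} ≥ Σ_{l ≤ i} β_q^{(l)}, with
equality for all i and all q ≥ q₀ exactly when `ShrinksFrom U q₀`. As I and A·I have the same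
Hilbert function, equality makes the vectors of I lexicographically maximal from q₀ on: by
`toLex_le_of_partial_sums`, a lexicographic excess would grow until the totals differ.

If lt I is quasi-stable, the terms violating the shrinking property have bounded degree, and one of
greatest degree yields a nonzero Koszul homology class. So shrinking starts at the regularity at the
latest (`IsQuasiStable.shrinksFrom`), which proves the first claim.

Conversely, over an infinite field generic linear forms are nonzerodivisors in large degrees, and
the reverse lexicographic order turns this into shrinking of lt (A·I) for some A
(`exists_transform_shrinksFrom`). In large degrees, at least the regularity of lt I, which is finite
by `regularity_lt_top`, the vectors of I and A·I dominate each other and so agree. The equality of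
sums thus passes to lt I, and shrinking implies quasi-stability (`isQuasiStable_of_shrinksFrom`). A
β-maximal ideal satisfies the inequalities in every degree, so it is covered too. -/

noncomputable section

namespace StablePosition

open MvPolynomial

/-! ### The largest variable of a term -/

section MaxVar

variable {n : ℕ}

/-- `X m` is the largest variable dividing the term `x^μ`. -/
def IsTopVar (μ : Fin n →₀ ℕ) (m : Fin n) : Prop :=
  μ m ≠ 0 ∧ ∀ l, m < l → μ l = 0

theorem maxVar_le_iff {μ : Fin n →₀ ℕ} {i : ℕ} :
    maxVar μ ≤ i ↔ ∀ l : Fin n, i < l → μ l = 0 := by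
  simp only [maxVar, Finset.sup_le_iff, Finsupp.mem_support_iff]
  exact forall_congr' fun l => by rw [← not_lt, not_imp_comm, not_not]

theorem IsTopVar.maxVar_eq {μ : Fin n →₀ ℕ} {m : Fin n} (h : IsTopVar μ m) :
    maxVar μ = m := by
  refine le_antisymm (maxVar_le_iff.2 fun l hl => h.2 l hl) ?_
  by_contra hlt
  exact h.1 (maxVar_le_iff.1 le_rfl m (not_le.1 hlt))

theorem exists_isTopVar {μ : Fin n →₀ ℕ} (h : μ ≠ 0) : ∃ m, IsTopVar μ m := by
  have hne : μ.support.Nonempty := Finsupp.support_nonempty_iff.2 h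
  refine ⟨μ.support.max' hne, Finsupp.mem_support_iff.1 (μ.support.max'_mem hne), fun l hl => ?_⟩
  by_contra hl0
  exact absurd (μ.support.le_max' l (Finsupp.mem_support_iff.2 hl0)) (not_le.2 hl)

theorem isTopVar_of_maxVar_eq {μ : Fin n →₀ ℕ} {m : Fin n} (h0 : μ ≠ 0) (h : maxVar μ = m) :
    IsTopVar μ m := by
  obtain ⟨m', hm'⟩ := exists_isTopVar h0
  rwa [← Fin.ext (hm'.maxVar_eq.symm.trans h)]

theorem isTopVar_add_single {μ : Fin n →₀ ℕ} {m : Fin n} (h : maxVar μ ≤ m) :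
    IsTopVar (μ + Finsupp.single m 1) m := by
  refine ⟨by simp, fun l hl => ?_⟩
  simp [maxVar_le_iff.1 h l hl, Finsupp.single_eq_of_ne hl.ne']

theorem single_le_of_ne_zero {μ : Fin n →₀ ℕ} {m : Fin n} (h : μ m ≠ 0) :
    Finsupp.single m 1 ≤ μ := by
  rw [Finsupp.single_le_iff]; omega

theorem maxVar_sub_single_le {μ : Fin n →₀ ℕ} {m : Fin n} (h : IsTopVar μ m) :
    maxVar (μ - Finsupp.single m 1) ≤ m :=
  maxVar_le_iff.2 fun l hl => by simp [h.2 l hl]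

theorem degree_sub_single {μ : Fin n →₀ ℕ} {m : Fin n} (h : μ m ≠ 0) :
    (μ - Finsupp.single m 1).degree + 1 = μ.degree := by
  conv_rhs => rw [← tsub_add_cancel_of_le (single_le_of_ne_zero h), map_add]
  simp

end MaxVar

/-! ### Counting terms by their largest variable -/

section Counting

variable {n : ℕ}

/-- The number of terms of degree `q` in `U` whose largest variable is `X i`. -/
def topCount (U : Set (Fin n →₀ ℕ)) (q : ℕ) (i : Fin n) : ℕ :=
  Set.ncard {μ : Fin n →₀ ℕ | μ.degree = q ∧ μ ∈ U ∧ maxVar μ = i}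

/-- From degree `q₀ + 1` on, dividing a term of `U` by its largest variable stays in `U`. -/
def ShrinksFrom (U : Set (Fin n →₀ ℕ)) (q₀ : ℕ) : Prop :=
  ∀ μ m, μ ∈ U → IsTopVar μ m → q₀ < μ.degree → μ - Finsupp.single m 1 ∈ U

theorem finite_degree_eq_and (q : ℕ) (p : (Fin n →₀ ℕ) → Prop) :
    {μ : Fin n →₀ ℕ | μ.degree = q ∧ p μ}.Finite :=
  (Finsupp.finite_of_degree_eq q).subset fun _ h => h.1

theorem ncard_maxVar_le (U : Set (Fin n →₀ ℕ)) (q : ℕ) (i : Fin n) :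
    Set.ncard {μ : Fin n →₀ ℕ | μ.degree = q ∧ μ ∈ U ∧ maxVar μ ≤ i} =
      ∑ l ∈ Finset.Iic i, topCount U q l := by
  classical
  have hfin := finite_degree_eq_and q (fun μ : Fin n →₀ ℕ => μ ∈ U ∧ maxVar μ ≤ i)
  -- The minimum only serves to produce an element of `Fin n`; on the set being counted it equals
  -- `maxVar μ`.
  rw [Set.ncard_eq_toFinset_card _ hfin, Finset.card_eq_sum_card_fiberwise
    (f := fun μ => (⟨min (maxVar μ) i, lt_of_le_of_lt (min_le_right _ _) i.2⟩ : Fin n))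
    (t := Finset.Iic i)]
  · refine Finset.sum_congr rfl fun l hl => ?_
    rw [topCount, Set.ncard_eq_toFinset_card _
      (finite_degree_eq_and q (fun μ : Fin n →₀ ℕ => μ ∈ U ∧ maxVar μ = l))]
    congr 1
    ext μ
    have hl' : (l : ℕ) ≤ i := Fin.le_def.1 (Finset.mem_Iic.1 hl)
    simp only [Finset.mem_filter, Set.Finite.mem_toFinset, Set.mem_ofPred_eq, Fin.ext_iff]
    constructor
    · rintro ⟨⟨h1, h2, h3⟩, h4⟩
      rw [min_eq_left h3] at h4
      exact ⟨h1, h2, h4⟩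
    · rintro ⟨h1, h2, h3⟩
      rw [h3]
      exact ⟨⟨h1, h2, hl'⟩, min_eq_left hl'⟩
  · intro μ _
    simp [Fin.le_def]

/-- For `n = 0` this fails: the term 1 has no index to be counted under. -/
theorem sum_topCount (hn : 0 < n) (U : Set (Fin n →₀ ℕ)) (q : ℕ) :
    ∑ l, topCount U q l = Set.ncard {μ : Fin n →₀ ℕ | μ.degree = q ∧ μ ∈ U} := by
  have h := ncard_maxVar_le U q ⟨n - 1, by omega⟩
  have h1 : (Finset.Iic (⟨n - 1, by omega⟩ : Fin n)) = Finset.univ := by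
    ext l
    simp only [Finset.mem_Iic, Fin.le_def, Finset.mem_univ, iff_true]
    omega
  rw [h1] at h
  rw [← h]
  congr 1
  ext μ
  have : maxVar μ ≤ n - 1 := maxVar_le_iff.2 fun l hl => by omega
  simp [this]

theorem mapsTo_add_single {U : Set (Fin n →₀ ℕ)} (hU : IsUpperSet U) (q : ℕ) (i : Fin n) :
    (fun μ => μ + Finsupp.single i 1) '' {μ : Fin n →₀ ℕ | μ.degree = q ∧ μ ∈ U ∧ maxVar μ ≤ i} ⊆
      {μ : Fin n →₀ ℕ | μ.degree = q + 1 ∧ μ ∈ U ∧ maxVar μ = i} := by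
  rintro _ ⟨μ, ⟨h1, h2, h3⟩, rfl⟩
  exact ⟨by simp [h1], hU le_self_add h2, (isTopVar_add_single h3).maxVar_eq⟩

theorem ncard_image_add_single (U : Set (Fin n →₀ ℕ)) (q : ℕ) (i : Fin n) :
    ((fun μ => μ + Finsupp.single i 1) ''
      {μ : Fin n →₀ ℕ | μ.degree = q ∧ μ ∈ U ∧ maxVar μ ≤ i}).ncard =
      ∑ l ∈ Finset.Iic i, topCount U q l := by
  rw [Set.ncard_image_of_injective _ (add_left_injective _), ncard_maxVar_le]

theorem sum_topCount_le {U : Set (Fin n →₀ ℕ)} (hU : IsUpperSet U) (q : ℕ) (i : Fin n) :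
    ∑ l ∈ Finset.Iic i, topCount U q l ≤ topCount U (q + 1) i := by
  rw [← ncard_image_add_single]
  exact Set.ncard_le_ncard (mapsTo_add_single hU q i) (finite_degree_eq_and _ _)

/-- Shrinking makes multiplication by `X i` surjective onto the terms with largest variable `X i`.
-/
theorem sum_topCount_eq {U : Set (Fin n →₀ ℕ)} (hU : IsUpperSet U) {q₀ q : ℕ}
    (h : ShrinksFrom U q₀) (hq : q₀ ≤ q) (i : Fin n) :
    ∑ l ∈ Finset.Iic i, topCount U q l = topCount U (q + 1) i := by
  rw [← ncard_image_add_single, topCount]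
  congr 1
  refine (mapsTo_add_single hU q i).antisymm ?_
  rintro μ ⟨h1, h2, h3⟩
  have hμ : μ ≠ 0 := by rintro rfl; simp at h1
  have ht := isTopVar_of_maxVar_eq hμ h3
  have := degree_sub_single ht.1
  exact ⟨μ - Finsupp.single i 1, ⟨by omega, h μ i h2 ht (by omega), maxVar_sub_single_le ht⟩,
    tsub_add_cancel_of_le (single_le_of_ne_zero ht.1)⟩

/-- An injection between finite sets of equal size is onto, and the preimage of a term is its
quotient by its largest variable. -/
theorem shrinksFrom_of_sum_topCount_eq {U : Set (Fin n →₀ ℕ)} (hU : IsUpperSet U) {q₀ : ℕ}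
    (h : ∀ q, q₀ ≤ q → ∀ i, ∑ l ∈ Finset.Iic i, topCount U q l = topCount U (q + 1) i) :
    ShrinksFrom U q₀ := by
  intro μ m hμ hm hq
  have h1 := h (μ.degree - 1) (by omega) m
  rw [← ncard_image_add_single, topCount] at h1
  have h2 := Set.eq_of_subset_of_ncard_le (mapsTo_add_single hU (μ.degree - 1) m) h1.ge
    (finite_degree_eq_and _ _)
  have h3 : μ ∈ {ν : Fin n →₀ ℕ | ν.degree = μ.degree - 1 + 1 ∧ ν ∈ U ∧ maxVar ν = m} :=
    ⟨by omega, hμ, hm.maxVar_eq⟩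
  rw [← h2] at h3
  obtain ⟨ν, hν, rfl⟩ := h3
  simpa using hν.2.1

/-- Sequences of vectors of the same total weight: if `b` evolves by taking partial sums, and `a`
grows at least as fast, then `a` is nowhere lexicographically larger than `b`. -/
theorem toLex_le_of_partial_sums {a b : ℕ → Fin n → ℕ} {q₀ : ℕ}
    (ha : ∀ q, q₀ ≤ q → ∀ i, ∑ l ∈ Finset.Iic i, a q l ≤ a (q + 1) i)
    (hb : ∀ q, q₀ ≤ q → ∀ i, ∑ l ∈ Finset.Iic i, b q l = b (q + 1) i)
    (hab : ∀ q, q₀ ≤ q → ∑ l, a q l = ∑ l, b q l) :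
    toLex (a q₀) ≤ toLex (b q₀) := by
  by_contra hlt
  rw [not_le] at hlt
  obtain ⟨j, hj, hj'⟩ := hlt
  replace hj : ∀ l < j, b q₀ l = a q₀ l := hj
  replace hj' : b q₀ j < a q₀ j := hj'
  set e : ℕ → Fin n → ℤ := fun r l => (a (q₀ + r) l : ℤ) - b (q₀ + r) l with he
  have hstep : ∀ r i, ∑ l ∈ Finset.Iic i, e r l ≤ e (r + 1) i := by
    intro r i
    have h1 := ha (q₀ + r) (by omega) i
    have h2 := hb (q₀ + r) (by omega) i
    simp only [he, Finset.sum_sub_distrib]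
    zify at h1 h2
    rw [h2]
    exact sub_le_sub_right h1 _
  -- The excess at the first differing index `j` persists, and nothing negative appears before it.
  have hlow : ∀ r, (∀ l < j, 0 ≤ e r l) ∧ 1 ≤ e r j := by
    intro r
    induction r with
    | zero => exact ⟨fun l hl => by simp [he, hj l hl], by simp [he]; omega⟩
    | succ r ih =>
      constructor
      · intro l hl
        exact (Finset.sum_nonneg fun x hx =>
          ih.1 x ((Finset.mem_Iic.1 hx).trans_lt hl)).trans (hstep r l)
      · refine le_trans ih.2 (le_trans ?_ (hstep r j))
        refine Finset.single_le_sum (f := e r) (fun x hx => ?_) (Finset.mem_Iic.2 le_rfl)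
        rcases (Finset.mem_Iic.1 hx).lt_or_eq with h | rfl
        · exact ih.1 x h
        · linarith [ih.2]
  -- Positivity spreads to the right of `j` one index at a time: once all entries from `j` up to the
  -- preceding one are positive, the next entry gains at least 1 per step, however negative it was.
  have hup : ∀ t : ℕ, ∃ R, ∀ r, R ≤ r → ∀ l : Fin n, j ≤ l → (l : ℕ) ≤ j + t → 1 ≤ e r l := by
    intro t
    induction t with
    | zero =>
      refine ⟨0, fun r _ l h1 h2 => ?_⟩
      obtain rfl : j = l := le_antisymm h1 (by simpa using h2)
      exact (hlow r).2
    | succ t ih =>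
      obtain ⟨R, hR⟩ := ih
      by_cases hi : (j : ℕ) + (t + 1) < n
      · set i : Fin n := ⟨j + (t + 1), hi⟩ with hi'
        have hgrow : ∀ r, R ≤ r → e r i + 1 ≤ e (r + 1) i := by
          intro r hr
          refine le_trans ?_ (hstep r i)
          have hji : j < i := by simp [hi', Fin.lt_def]
          rw [← Finset.Iio_insert, Finset.sum_insert (by simp)]
          refine add_le_add_right (le_trans (hlow r).2 ?_) _
          refine Finset.single_le_sum (f := e r) (fun x hx => ?_) (Finset.mem_Iio.2 hji)
          rcases lt_or_ge x j with h | h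
          · exact (hlow r).1 x h
          · have := Finset.mem_Iio.1 hx
            simp only [hi', Fin.lt_def] at this
            linarith [hR r hr x h (by omega)]
        have hlin : ∀ s : ℕ, e R i + s ≤ e (R + s) i := by
          intro s
          induction s with
          | zero => simp
          | succ s ihs =>
            have := hgrow (R + s) (by omega)
            push_cast
            rw [← add_assoc R]
            linarith
        refine ⟨R + (1 - e R i).toNat, fun r hr l h1 h2 => ?_⟩
        rcases Nat.lt_or_ge l (j + (t + 1)) with h | h
        · exact hR r (by omega) l h1 (by omega)
        · obtain rfl : l = i := Fin.ext (le_antisymm h2 h)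
          obtain ⟨s, rfl⟩ := Nat.exists_eq_add_of_le (show R ≤ r by omega)
          have := hlin s
          omega
      · exact ⟨R, fun r hr l h1 h2 => hR r hr l h1 (by omega)⟩
  obtain ⟨R, hR⟩ := hup n
  have htot : ∑ l, e R l = 0 := by
    simp only [he, Finset.sum_sub_distrib]
    have := hab (q₀ + R) (by omega)
    zify at this
    linarith
  have hpos : 0 < ∑ l, e R l := by
    refine Finset.sum_pos' (fun l _ => ?_) ⟨j, Finset.mem_univ _, by linarith [(hlow R).2]⟩
    rcases lt_or_ge l j with h | h
    · exact (hlow R).1 l h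
    · linarith [hR R le_rfl l h (by omega)]
  omega

theorem toLex_topCount_le {U V : Set (Fin n →₀ ℕ)} (hU : IsUpperSet U) (hV : IsUpperSet V)
    {q₀ q : ℕ} (h : ShrinksFrom V q₀) (hq : q₀ ≤ q)
    (hcard : ∀ q, Set.ncard {μ : Fin n →₀ ℕ | μ.degree = q ∧ μ ∈ U} =
      Set.ncard {μ : Fin n →₀ ℕ | μ.degree = q ∧ μ ∈ V}) :
    toLex (topCount U q) ≤ toLex (topCount V q) := by
  rcases Nat.eq_zero_or_pos n with rfl | hn
  · exact le_of_eq (congrArg toLex (Subsingleton.elim _ _))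
  · refine toLex_le_of_partial_sums (fun q _ i => sum_topCount_le hU q i)
      (fun q' hq' i => sum_topCount_eq hV h (hq.trans hq') i) fun q' _ => ?_
    rw [sum_topCount hn, sum_topCount hn, hcard]

end Counting

/-! ### Monomial ideals and leading ideals -/

section LeadingIdeal

variable {k : Type*} [Field k] {n : ℕ}

/-- The exponents of the terms in an ideal. -/
def exponents (J : Ideal (MvPolynomial (Fin n) k)) : Set (Fin n →₀ ℕ) :=
  {μ | monomial μ (1 : k) ∈ J}

theorem mem_exponents {J : Ideal (MvPolynomial (Fin n) k)} {μ : Fin n →₀ ℕ} :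
    μ ∈ exponents J ↔ monomial μ (1 : k) ∈ J := Iff.rfl

theorem isUpperSet_exponents (J : Ideal (MvPolynomial (Fin n) k)) :
    IsUpperSet (exponents J) := by
  intro μ ν h hμ
  have : monomial ν (1 : k) = monomial (ν - μ) 1 * monomial μ 1 := by
    rw [monomial_mul, tsub_add_cancel_of_le h, one_mul]
  rw [mem_exponents] at hμ ⊢
  exact this ▸ J.mul_mem_left _ hμ

/-- An ideal is monomial if it consists of the polynomials all of whose terms it contains. -/
def IsMonomialIdeal (J : Ideal (MvPolynomial (Fin n) k)) : Prop :=
  ∀ p, p ∈ J ↔ ∀ μ ∈ p.support, μ ∈ exponents J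

/-- An ideal is graded if it contains the homogeneous components of its elements. -/
def IsGradedIdeal (J : Ideal (MvPolynomial (Fin n) k)) : Prop :=
  ∀ p ∈ J, ∀ d, homogeneousComponent d p ∈ J

theorem isMonomialIdeal_span (s : Set (Fin n →₀ ℕ)) :
    IsMonomialIdeal (Ideal.span ((fun μ => monomial μ (1 : k)) '' s)) := by
  classical
  intro p
  rw [mem_ideal_span_monomial_image]
  refine forall₂_congr fun μ _ => ?_
  rw [mem_exponents, mem_ideal_span_monomial_image]
  simp [support_monomial]

theorem IsMonomialIdeal.isGradedIdeal {J : Ideal (MvPolynomial (Fin n) k)}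
    (hJ : IsMonomialIdeal J) : IsGradedIdeal J := by
  intro p hp d
  rw [hJ] at hp ⊢
  intro μ hμ
  rw [support_homogeneousComponent] at hμ
  exact hp μ (Finset.mem_filter.1 hμ).1

theorem IsMonomialIdeal.coeff_eq_zero {J : Ideal (MvPolynomial (Fin n) k)}
    (hJ : IsMonomialIdeal J) {p : MvPolynomial (Fin n) k} (hp : p ∈ J) {μ : Fin n →₀ ℕ}
    (hμ : μ ∉ exponents J) : coeff μ p = 0 :=
  notMem_support_iff.1 fun h => hμ ((hJ p).1 hp μ h)

variable (m : MonomialOrder (Fin n))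

theorem mul_monomial_degree {f : MvPolynomial (Fin n) k} (hf : f ≠ 0) (μ : Fin n →₀ ℕ) :
    m.degree (monomial μ (1 : k) * f) = μ + m.degree f := by
  classical
  rw [m.degree_mul (by simp) hf, m.degree_monomial, if_neg one_ne_zero]

theorem leadingIdeal_eq_span_image (I : Ideal (MvPolynomial (Fin n) k)) :
    leadingIdeal m I = Ideal.span ((fun μ => monomial μ (1 : k)) ''
      {μ | ∃ f ∈ I, f ≠ 0 ∧ m.degree f = μ}) := by
  rw [leadingIdeal]
  congr 1
  ext t
  constructor
  · rintro ⟨f, hf, h0, rfl⟩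
    exact ⟨_, ⟨f, hf, h0, rfl⟩, rfl⟩
  · rintro ⟨_, ⟨f, hf, h0, rfl⟩, rfl⟩
    exact ⟨f, hf, h0, rfl⟩

theorem isMonomialIdeal_leadingIdeal (I : Ideal (MvPolynomial (Fin n) k)) :
    IsMonomialIdeal (leadingIdeal m I) := by
  rw [leadingIdeal_eq_span_image]
  exact isMonomialIdeal_span _

/-- Leading exponents are already closed under adding exponents, so passing to the generated ideal
creates no new terms. -/
theorem mem_exponents_leadingIdeal {I : Ideal (MvPolynomial (Fin n) k)} {μ : Fin n →₀ ℕ} :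
    μ ∈ exponents (leadingIdeal m I) ↔ ∃ f ∈ I, f ≠ 0 ∧ m.degree f = μ := by
  classical
  rw [mem_exponents, leadingIdeal_eq_span_image, mem_ideal_span_monomial_image]
  constructor
  · intro h
    obtain ⟨_, ⟨f, hf, h0, rfl⟩, hle⟩ := h μ (by simp [support_monomial])
    refine ⟨monomial (μ - m.degree f) 1 * f, I.mul_mem_left _ hf, mul_ne_zero (by simp) h0, ?_⟩
    rw [mul_monomial_degree m h0, tsub_add_cancel_of_le hle]
  · rintro ⟨f, hf, h0, rfl⟩ ν hν
    rw [support_monomial, if_neg one_ne_zero, Finset.mem_singleton] at hν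
    exact ⟨_, ⟨f, hf, h0, rfl⟩, hν.ge⟩

/-- In a graded ideal, leading terms are attained by homogeneous elements. -/
theorem exists_isHomogeneous_of_mem_exponents {I : Ideal (MvPolynomial (Fin n) k)}
    (hI : IsGradedIdeal I) {μ : Fin n →₀ ℕ} (hμ : μ ∈ exponents (leadingIdeal m I)) :
    ∃ f ∈ I, f ≠ 0 ∧ f.IsHomogeneous μ.degree ∧ m.degree f = μ := by
  obtain ⟨f, hf, h0, rfl⟩ := (mem_exponents_leadingIdeal m).1 hμ
  have hc : coeff (m.degree f) (homogeneousComponent (m.degree f).degree f) ≠ 0 := by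
    rw [coeff_homogeneousComponent, if_pos rfl]
    exact mem_support_iff.1 (m.degree_mem_support h0)
  refine ⟨_, hI f hf _, fun h => hc (by simp [h]), homogeneousComponent_isHomogeneous _ _, ?_⟩
  refine m.toSyn.injective (le_antisymm ?_ (m.le_degree (mem_support_iff.2 hc)))
  refine m.degree_le_iff.2 fun ν hν => m.le_degree ?_
  rw [support_homogeneousComponent] at hν
  exact (Finset.mem_filter.1 hν).1

/-! ### The Hilbert function -/

/-- The homogeneous elements of degree `q` of an ideal. -/
def gradedPiece (I : Ideal (MvPolynomial (Fin n) k)) (q : ℕ) :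
    Submodule k (MvPolynomial (Fin n) k) :=
  I.restrictScalars k ⊓ homogeneousSubmodule (Fin n) k q

theorem mem_gradedPiece {I : Ideal (MvPolynomial (Fin n) k)} {q : ℕ}
    {f : MvPolynomial (Fin n) k} : f ∈ gradedPiece I q ↔ f ∈ I ∧ f.IsHomogeneous q := Iff.rfl

/-- An ideal and its leading ideal have the same Hilbert function. -/
theorem ncard_exponents_leadingIdeal {I : Ideal (MvPolynomial (Fin n) k)}
    (hI : IsGradedIdeal I) (q : ℕ) :
    Set.ncard {μ : Fin n →₀ ℕ | μ.degree = q ∧ μ ∈ exponents (leadingIdeal m I)} =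
      Module.finrank k (gradedPiece I q) := by
  classical
  set S := {μ : Fin n →₀ ℕ | μ.degree = q ∧ μ ∈ exponents (leadingIdeal m I)} with hS
  have hfin : S.Finite := finite_degree_eq_and q _
  have := hfin.fintype
  -- Upper bound: a nonzero element has a nonzero coefficient at its leading exponent, so reading
  -- off the coefficients at `S` is injective.
  let ev : gradedPiece I q →ₗ[k] (S → k) :=
    LinearMap.pi fun s => (lcoeff k s.1).comp (gradedPiece I q).subtype
  have hev : Function.Injective ev := by
    rw [← LinearMap.ker_eq_bot, LinearMap.ker_eq_bot']
    rintro ⟨f, hf⟩ h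
    by_contra h0
    have h0' : f ≠ 0 := fun h => h0 (Subtype.ext h)
    have hd : m.degree f ∈ S :=
      ⟨hf.2.degree_eq_sum_deg_support (m.degree_mem_support h0') |>.symm,
        (mem_exponents_leadingIdeal m).2 ⟨f, hf.1, h0', rfl⟩⟩
    exact mem_support_iff.1 (m.degree_mem_support h0') (congrFun h ⟨_, hd⟩)
  have hfd : Module.Finite k (gradedPiece I q) := Module.Finite.of_injective ev hev
  -- Lower bound: elements with distinct leading exponents are independent, as the largest one
  -- occurring in a relation cannot cancel.
  have hex : ∀ s : S, ∃ f : gradedPiece I q, f.1 ≠ 0 ∧ m.degree f.1 = s.1 := by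
    rintro ⟨μ, hμ, hμ'⟩
    obtain ⟨f, hf, h0, hh, hd⟩ := exists_isHomogeneous_of_mem_exponents m hI hμ'
    exact ⟨⟨f, hf, hμ ▸ hh⟩, h0, hd⟩
  choose F hF0 hFd using hex
  have hli : LinearIndependent k F := by
    rw [Fintype.linearIndependent_iff]
    intro c hc
    by_contra hne
    push Not at hne
    obtain ⟨s, hs, hmax⟩ := Finset.exists_max_image (Finset.univ.filter fun s => c s ≠ 0)
      (fun s : S => m.toSyn s.1) (by obtain ⟨i, hi⟩ := hne; exact ⟨i, by simp [hi]⟩)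
    have hs' : c s ≠ 0 := (Finset.mem_filter.1 hs).2
    have h1 := congrArg (fun f : gradedPiece I q => coeff s.1 f.1) hc
    simp only [Submodule.coe_sum, Submodule.coe_smul, coeff_sum, coeff_smul, ZeroMemClass.coe_zero,
      coeff_zero, smul_eq_mul] at h1
    rw [Finset.sum_eq_single s] at h1
    · have h2 : coeff s.1 (F s).1 ≠ 0 := by
        rw [← hFd s]
        exact mem_support_iff.1 (m.degree_mem_support (hF0 s))
      exact (mul_ne_zero hs' h2) h1
    · intro t _ hts
      by_cases hct : c t = 0
      · simp [hct]
      · rw [m.coeff_eq_zero_of_lt, mul_zero]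
        rw [hFd t]
        exact lt_of_le_of_ne (hmax t (by simp [hct]))
          fun h => hts (Subtype.ext (m.toSyn.injective h))
    · simp
  refine le_antisymm ?_ ?_
  · rw [← Nat.card_coe_set_eq, Nat.card_eq_fintype_card]
    exact hli.fintype_card_le_finrank
  · refine (LinearMap.finrank_le_finrank_of_injective hev).trans ?_
    rw [Module.finrank_fintype_fun_eq_card, ← Nat.card_coe_set_eq, Nat.card_eq_fintype_card]

/-! ### Linear coordinate changes -/

/-- Substitution reverses the order: the rows of `A` are substituted into the linear forms given by
the rows of `B`. -/
theorem coordChange_comp (A B : Matrix.GeneralLinearGroup (Fin n) k)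
    (p : MvPolynomial (Fin n) k) :
    coordChange A (coordChange B p) = coordChange (B * A) p := by
  have : (coordChange A).comp (coordChange B) = coordChange (B * A) := by
    ext1 i
    simp only [coordChange, AlgHom.comp_apply, aeval_X, map_sum, map_mul, algHom_C,
      algebraMap_eq, Units.val_mul, Matrix.mul_apply, Finset.sum_mul, Finset.mul_sum]
    rw [Finset.sum_comm]
    refine Finset.sum_congr rfl fun j _ => Finset.sum_congr rfl fun l _ => by ring
  exact DFunLike.congr_fun this p

theorem coordChange_one (p : MvPolynomial (Fin n) k) : coordChange 1 p = p := by
  have : coordChange (1 : Matrix.GeneralLinearGroup (Fin n) k) = AlgHom.id k _ := by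
    ext1 i
    simp [coordChange, Matrix.one_apply]
  rw [this]
  rfl

theorem coordChange_inv_apply (A : Matrix.GeneralLinearGroup (Fin n) k)
    (p : MvPolynomial (Fin n) k) : coordChange A⁻¹ (coordChange A p) = p := by
  rw [coordChange_comp, mul_inv_cancel, coordChange_one]

theorem coordChange_apply_inv (A : Matrix.GeneralLinearGroup (Fin n) k)
    (p : MvPolynomial (Fin n) k) : coordChange A (coordChange A⁻¹ p) = p := by
  rw [coordChange_comp, inv_mul_cancel, coordChange_one]

theorem isHomogeneous_coordChange (A : Matrix.GeneralLinearGroup (Fin n) k)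
    {p : MvPolynomial (Fin n) k} {d : ℕ} (hp : p.IsHomogeneous d) :
    (coordChange A p).IsHomogeneous d := by
  have := hp.aeval (S := k) (n := 1)
    (g := fun i => ∑ j, C ((A : Matrix (Fin n) (Fin n) k) i j) * X j)
    fun i => IsHomogeneous.sum _ _ _ fun j _ => isHomogeneous_C_mul_X _ _
  rwa [one_mul] at this

theorem mem_transform_iff {A : Matrix.GeneralLinearGroup (Fin n) k}
    {I : Ideal (MvPolynomial (Fin n) k)} {p : MvPolynomial (Fin n) k} :
    p ∈ transform A I ↔ coordChange A⁻¹ p ∈ I := by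
  constructor
  · intro h
    have h1 : (transform A I).map (coordChange A⁻¹) ≤ I := by
      rw [transform, Ideal.map_le_iff_le_comap, Ideal.map_le_iff_le_comap]
      intro q hq
      simpa [Ideal.mem_comap, coordChange_inv_apply] using hq
    exact h1 (Ideal.mem_map_of_mem _ h)
  · intro h
    rw [← coordChange_apply_inv A p]
    exact Ideal.mem_map_of_mem _ h

theorem transform_inv_transform (A : Matrix.GeneralLinearGroup (Fin n) k)
    (I : Ideal (MvPolynomial (Fin n) k)) : transform A⁻¹ (transform A I) = I := by
  ext p
  rw [mem_transform_iff, mem_transform_iff, inv_inv, coordChange_inv_apply]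

theorem homogeneousComponent_coordChange (A : Matrix.GeneralLinearGroup (Fin n) k)
    (p : MvPolynomial (Fin n) k) (d : ℕ) :
    homogeneousComponent d (coordChange A p) = coordChange A (homogeneousComponent d p) := by
  conv_lhs => rw [← sum_homogeneousComponent p, map_sum, map_sum]
  rw [Finset.sum_congr rfl fun i _ => homogeneousComponent_of_mem (n := i)
    (isHomogeneous_coordChange A (homogeneousComponent_isHomogeneous i p))]
  by_cases hd : d ≤ p.totalDegree
  · simp [Finset.sum_ite_eq, hd]
  · rw [homogeneousComponent_eq_zero _ _ (not_le.1 hd), map_zero]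
    exact Finset.sum_eq_zero fun i hi => if_neg (by have := Finset.mem_range.1 hi; omega)

theorem IsGradedIdeal.transform {I : Ideal (MvPolynomial (Fin n) k)} (hI : IsGradedIdeal I)
    (A : Matrix.GeneralLinearGroup (Fin n) k) : IsGradedIdeal (transform A I) := by
  intro p hp d
  rw [mem_transform_iff] at hp ⊢
  rw [← homogeneousComponent_coordChange]
  exact hI _ hp d

theorem finrank_gradedPiece_transform (A : Matrix.GeneralLinearGroup (Fin n) k)
    (I : Ideal (MvPolynomial (Fin n) k)) (q : ℕ) :
    Module.finrank k (gradedPiece (transform A I) q) = Module.finrank k (gradedPiece I q) := by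
  have hinj : Function.Injective (coordChange A).toLinearMap :=
    Function.LeftInverse.injective (coordChange_inv_apply A)
  have : gradedPiece (transform A I) q = (gradedPiece I q).map (coordChange A).toLinearMap := by
    ext p
    rw [mem_gradedPiece, mem_transform_iff, Submodule.mem_map]
    constructor
    · rintro ⟨h1, h2⟩
      exact ⟨_, ⟨h1, isHomogeneous_coordChange _ h2⟩, coordChange_apply_inv A p⟩
    · rintro ⟨f, ⟨h1, h2⟩, rfl⟩
      refine ⟨?_, isHomogeneous_coordChange _ h2⟩
      simpa [coordChange_inv_apply] using h1
  rw [this]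
  exact (Submodule.equivMapOfInjective _ hinj _).finrank_eq.symm

theorem betaVector_eq_topCount (I : Ideal (MvPolynomial (Fin n) k)) (q : ℕ) :
    betaVector m I q = topCount (exponents (leadingIdeal m I)) q := rfl

theorem betaVector_transform_le {I : Ideal (MvPolynomial (Fin n) k)} (hI : IsGradedIdeal I)
    (A : Matrix.GeneralLinearGroup (Fin n) k) {q₀ q : ℕ}
    (h : ShrinksFrom (exponents (leadingIdeal m I)) q₀) (hq : q₀ ≤ q) :
    toLex (betaVector m (transform A I) q) ≤ toLex (betaVector m I q) := by
  rw [betaVector_eq_topCount, betaVector_eq_topCount]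
  refine toLex_topCount_le (isUpperSet_exponents _) (isUpperSet_exponents _) h hq fun d => ?_
  rw [ncard_exponents_leadingIdeal m (hI.transform A), ncard_exponents_leadingIdeal m hI,
    finrank_gradedPiece_transform]

end LeadingIdeal

/-! ### Quasi-stable ideals -/

section QuasiStable

variable {k : Type*} [Field k] {n : ℕ} {J : Ideal (MvPolynomial (Fin n) k)}

theorem exists_mem_exponents_le (J : Ideal (MvPolynomial (Fin n) k)) {μ : Fin n →₀ ℕ}
    (hμ : μ ∈ exponents J) : ∃ ν ∈ exponents J, ν ≤ μ ∧ ∀ i, ν i ≤ maxGenDegree J := by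
  obtain ⟨ν, hνμ, hν⟩ :=
    exists_minimal_le_of_wellFoundedLT (fun ν => monomial ν (1 : k) ∈ J) μ hμ
  -- Dickson's lemma: there are finitely many minimal generators, so the supremum in `maxGenDegree`
  -- is a genuine upper bound.
  have hfin : {ν : Fin n →₀ ℕ | Minimal (fun ν => monomial ν (1 : k) ∈ J) ν}.Finite :=
    WellQuasiOrderedLE.finite_of_isAntichain (setOfPred_minimal_antichain _)
  refine ⟨ν, hν.prop, hνμ, fun i => (Finsupp.le_degree i ν).trans ?_⟩
  exact le_csSup (hfin.image Finsupp.degree).bddAbove ⟨ν, hν, rfl⟩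

/-- A minimal generator ν dividing μ has the same exponent at `m`, or it would divide μ / x_m. With
d = `maxGenDegree J`, an exponent of μ above 2d at some j < m would make x_j^d ν / x_m^{ν_m}, which
lies in `J`, divide μ / x_m. So every exponent is at most 2d. -/
theorem IsQuasiStable.degree_le (hJ : IsQuasiStable J) {μ : Fin n →₀ ℕ} {m : Fin n}
    (hμ : μ ∈ exponents J) (hm : IsTopVar μ m) (h : μ - Finsupp.single m 1 ∉ exponents J) :
    μ.degree ≤ n * (2 * maxGenDegree J) := by
  obtain ⟨ν, hν, hle, hdeg⟩ := exists_mem_exponents_le J hμ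
  have hνm : ν m = μ m := by
    by_contra hne
    refine h (isUpperSet_exponents J (fun i => ?_) hν)
    have h1 := hle i
    have h2 := hle m
    rcases eq_or_ne i m with rfl | hi
    · simp only [Finsupp.tsub_apply, Finsupp.single_eq_same]
      omega
    · simpa [Finsupp.single_eq_of_ne hi] using h1
  have htop : IsTopVar ν m :=
    ⟨hνm ▸ hm.1, fun l hl => Nat.le_zero.1 ((hle l).trans (hm.2 l hl).le)⟩
  have hbound : ∀ j, μ j ≤ 2 * maxGenDegree J := by
    intro j
    rcases lt_trichotomy j m with hj | rfl | hj
    · by_contra! hlt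
      refine h (isUpperSet_exponents J (fun i => ?_) (hJ ν hν j m htop.maxVar_eq.symm hj))
      have h1 := hle i
      have h2 := hdeg i
      rcases eq_or_ne i m with rfl | him
      · simp [Finsupp.single_eq_of_ne hj.ne']
      · rcases eq_or_ne i j with rfl | hij
        · simp [Finsupp.single_eq_of_ne him, Finsupp.erase_ne him]
          omega
        · simpa [Finsupp.single_eq_of_ne him, Finsupp.single_eq_of_ne hij,
            Finsupp.erase_ne him] using h1
    · have := hdeg j
      omega
    · simp [hm.2 j hj]
  rw [Finsupp.degree_eq_sum]
  refine (Finset.sum_le_sum fun i _ => hbound i).trans ?_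
  simp

/-- After multiplication by x_j^{q₀+1} the degree stays above q₀ while all factors x_m are stripped
off. A minimal generator dividing the result has exponent at most `maxGenDegree J` at `j`, so that
power of x_j suffices. -/
theorem isQuasiStable_of_shrinksFrom {q₀ : ℕ} (h : ShrinksFrom (exponents J) q₀) :
    IsQuasiStable J := by
  intro μ hμ j m hm hjm
  have hj' : (j : ℕ) < m := hjm
  have htop : IsTopVar μ m := by
    refine isTopVar_of_maxVar_eq ?_ hm.symm
    rintro rfl
    simp [maxVar] at hm
    omega
  have key : ∀ a, μ.erase m + Finsupp.single m a + Finsupp.single j (q₀ + 1) ∈ exponents J →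
      μ.erase m + Finsupp.single j (q₀ + 1) ∈ exponents J := by
    intro a
    induction a with
    | zero => simp
    | succ a ih =>
      intro ha
      refine ih ?_
      have h1 := h _ m ha ⟨by simp [Finsupp.single_eq_of_ne hjm.ne'], fun l hl => ?_⟩ ?_
      · convert! h1 using 1
        ext i
        rcases eq_or_ne i m with rfl | hi
        · simp [Finsupp.single_eq_of_ne hjm.ne']
        · simp [Finsupp.single_eq_of_ne hi]
      · simp [Finsupp.single_eq_of_ne hl.ne', Finsupp.single_eq_of_ne (hjm.trans hl).ne',
          Finsupp.erase_ne hl.ne', htop.2 l hl]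
      · simp only [map_add, Finsupp.degree_single]
        omega
  have hbig : μ.erase m + Finsupp.single j (q₀ + 1) ∈ exponents J := by
    refine key (μ m) (isUpperSet_exponents J ?_ hμ)
    rw [Finsupp.erase_add_single]
    exact le_self_add
  obtain ⟨ν, hν, hle, hdeg⟩ := exists_mem_exponents_le J hbig
  refine isUpperSet_exponents J (fun i => ?_) hν
  have h1 := hle i
  have h2 := hdeg i
  rcases eq_or_ne i j with rfl | hi
  · simp only [Finsupp.add_apply, Finsupp.single_eq_same]
    omega
  · simpa [Finsupp.single_eq_of_ne hi] using h1

end QuasiStable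

/-! ### The Koszul complex -/

section Koszul

variable {k : Type*} [Field k] {n : ℕ} {J : Ideal (MvPolynomial (Fin n) k)}

theorem card_filter_lt_insert {T : Finset (Fin n)} {l : Fin n} (hl : l ∉ T) (i : Fin n) :
    ((insert l T).filter (· < i)).card = (T.filter (· < i)).card + if l < i then 1 else 0 := by
  rw [Finset.filter_insert]
  split_ifs with h
  · rw [Finset.card_insert_of_notMem (by simp [hl])]
  · rfl

/-- Adjoining two indices in either order gives opposite Koszul signs. -/
theorem koszul_sign_swap {T : Finset (Fin n)} {l i : Fin n} (hl : l ∉ T) (hi : i ∉ T)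
    (hli : l ≠ i) :
    (-1 : MvPolynomial (Fin n) k) ^ (T.filter (· < l)).card *
        (-1) ^ ((insert l T).filter (· < i)).card =
      -((-1) ^ (T.filter (· < i)).card * (-1) ^ ((insert i T).filter (· < l)).card) := by
  rw [card_filter_lt_insert hl, card_filter_lt_insert hi]
  rcases lt_or_gt_of_ne hli with h | h
  · rw [if_pos h, if_neg h.asymm]
    ring
  · rw [if_neg h.asymm, if_pos h]
    ring

theorem coeff_neg_one_pow_mul (a : ℕ) (p : MvPolynomial (Fin n) k) (μ : Fin n →₀ ℕ) :
    coeff μ ((-1) ^ a * p) = (-1) ^ a * coeff μ p := by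
  rcases Nat.even_or_odd a with ha | ha <;>
    simp [ha.neg_one_pow]

/-- The summands for (l, i) and (i, l) cancel by `koszul_sign_swap`. -/
theorem koszulDifferential_koszulDifferential (c : Finset (Fin n) → MvPolynomial (Fin n) k) :
    koszulDifferential (koszulDifferential c) = 0 := by
  funext T
  simp only [koszulDifferential, Finset.mul_sum, Pi.zero_apply]
  rw [Finset.sum_sigma']
  refine Finset.sum_involution (fun p _ => ⟨p.2, p.1⟩) ?_ ?_ ?_ ?_
  · rintro ⟨l, i⟩ h
    simp only [Finset.mem_sigma, Finset.mem_compl, Finset.mem_insert, not_or] at h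
    obtain ⟨hl, hil, hi⟩ := h
    have hs := koszul_sign_swap (k := k) hl hi (Ne.symm hil)
    have hc : insert i (insert l T) = insert l (insert i T) := Finset.insert_comm _ _ _
    simp only [hc]
    linear_combination (X l * X i * c (insert l (insert i T))) * hs
  · rintro ⟨l, i⟩ h _ heq
    simp only [Finset.mem_sigma, Finset.mem_compl, Finset.mem_insert, not_or] at h
    simp only [Sigma.mk.injEq] at heq
    exact h.2.1 heq.1
  · rintro ⟨l, i⟩ h
    simp only [Finset.mem_sigma, Finset.mem_compl, Finset.mem_insert, not_or] at h ⊢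
    exact ⟨h.2.2, Ne.symm h.2.1, h.1⟩
  · rintro ⟨l, i⟩ _
    rfl

theorem le_regularity {i j : ℕ} (h : TorNonzero J i j) : (j : ℕ∞) ≤ regularity J :=
  le_iSup_of_le i (le_iSup_of_le j (le_iSup_of_le h le_rfl))

/-- The syzygy `x_m · x^u ∈ J`, `x^u ∉ J` gives a nonzero class in the Koszul homology of `J`. -/
theorem torNonzero_of_isTopVar (hJ : IsMonomialIdeal J) {μ : Fin n →₀ ℕ} {m : Fin n}
    (hμ : μ ∈ exponents J) (hm : IsTopVar μ m) (hμm : μ - Finsupp.single m 1 ∉ exponents J)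
    (hsyz : ∀ l < m, μ - Finsupp.single m 1 + Finsupp.single l 1 ∈ exponents J) :
    TorNonzero J m μ.degree := by
  set u := μ - Finsupp.single m 1 with hu
  have hum : u + Finsupp.single m 1 = μ := tsub_add_cancel_of_le (single_le_of_ne_zero hm.1)
  have hdeg : u.degree + 1 = μ.degree := degree_sub_single hm.1
  -- This chain is not in the complex of `J`, since x^u ∉ `J`, but its boundary is: the coefficients
  -- are, up to sign, the terms x_l x^u with l ≤ m.
  let e : Finset (Fin n) → MvPolynomial (Fin n) k :=
    fun S => if S = Finset.Iic m then monomial u 1 else 0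
  have hXe : ∀ l T, l ∉ T → X l * e (insert l T) = 0 ∨
      (insert l T = Finset.Iic m ∧
        X l * e (insert l T) = monomial (u + Finsupp.single l 1) 1) := by
    intro l T _
    by_cases h : insert l T = Finset.Iic m
    · right
      refine ⟨h, ?_⟩
      simp only [e, if_pos h]
      rw [X, monomial_mul, add_comm, one_mul]
    · left
      simp [e, if_neg h]
  refine ⟨koszulDifferential e, ⟨fun T => ?_, fun T hT => ?_⟩, fun T => ?_,
    koszulDifferential_koszulDifferential e, ?_⟩
  · refine J.sum_mem fun l hl => J.mul_mem_left _ ?_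
    rcases hXe l T (Finset.mem_compl.1 hl) with h | ⟨hS, h⟩
    · rw [h]; exact J.zero_mem
    · rw [h]
      have hlm : l ≤ m := Finset.mem_Iic.1 (hS ▸ Finset.mem_insert_self l T)
      rcases hlm.lt_or_eq with hlt | rfl
      · exact hsyz l hlt
      · rw [hum]; exact hμ
  · refine Finset.sum_eq_zero fun l hl => ?_
    rcases hXe l T (Finset.mem_compl.1 hl) with h | ⟨hS, _⟩
    · rw [h, mul_zero]
    · refine absurd ?_ hT
      have := congrArg Finset.card hS
      rw [Finset.card_insert_of_notMem (Finset.mem_compl.1 hl), Fin.card_Iic] at this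
      omega
  · refine IsHomogeneous.sum _ _ _ fun l hl => ?_
    have hh : (X l * e (insert l T)).IsHomogeneous μ.degree := by
      rcases hXe l T (Finset.mem_compl.1 hl) with h | ⟨_, h⟩
      · rw [h]; exact isHomogeneous_zero _ _ _
      · rw [h]; exact isHomogeneous_monomial _ (by simp [hdeg])
    rcases neg_one_pow_eq_or (MvPolynomial (Fin n) k) (T.filter (· < l)).card with h | h
    · rw [h, one_mul]; exact hh
    · rw [h, neg_one_mul]; exact hh.neg
  · rintro ⟨b, hb, hbe⟩
    have hins : insert m (Finset.Iio m) = Finset.Iic m := Finset.Iio_insert m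
    -- For a chain `b` over `J`, the coefficient of x^μ at this component vanishes: a variable
    -- beyond x_m does not divide x^μ, and l = m would need the term x^u in an element of `J`. For
    -- `e` the same coefficient is ±1.
    have h1 : coeff μ (koszulDifferential b (Finset.Iio m)) = 0 := by
      simp only [koszulDifferential, coeff_sum]
      refine Finset.sum_eq_zero fun l hl => ?_
      rw [coeff_neg_one_pow_mul, coeff_X_mul']
      split_ifs with hlμ
      · have hle : m ≤ l := by simpa using hl
        rcases hle.lt_or_eq with hlt | rfl
        · exact absurd (hm.2 l hlt) (Finsupp.mem_support_iff.1 hlμ)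
        · rw [hJ.coeff_eq_zero (hb.1 _) hμm, mul_zero]
      · rw [mul_zero]
    have h2 : koszulDifferential e (Finset.Iio m) =
        (-1) ^ ((Finset.Iio m).filter (· < m)).card * monomial μ 1 := by
      rw [koszulDifferential, Finset.sum_eq_single m]
      · rw [hins]
        simp only [e, if_true]
        rw [X, monomial_mul, add_comm, one_mul, hum]
      · intro l hl hlm
        rcases hXe l _ (Finset.mem_compl.1 hl) with h | ⟨hS, _⟩
        · rw [h, mul_zero]
        · have h3 : l ≤ m := Finset.mem_Iic.1 (hS ▸ Finset.mem_insert_self l _)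
          have h4 : m ≤ l := by simpa using hl
          exact absurd (le_antisymm h3 h4) hlm
      · simp
    rw [hbe, h2, coeff_neg_one_pow_mul] at h1
    simp at h1

/-- Among the terms μ ∈ `J` with μ / x_m ∉ `J`, of bounded degree by `IsQuasiStable.degree_le`, take
one of greatest degree. For l < m the term x_l μ / x_m lies in `J`, or x_l μ would be a larger such
term. So `torNonzero_of_isTopVar` applies and bounds the degree by the regularity. -/
theorem IsQuasiStable.shrinksFrom (hq : IsQuasiStable J) (hJ : IsMonomialIdeal J) {q : ℕ}
    (hreg : regularity J ≤ q) : ShrinksFrom (exponents J) q := by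
  by_contra hcon
  simp only [ShrinksFrom, not_forall] at hcon
  obtain ⟨μ₀, m₀, hμ₀, hm₀, hd₀, hμm₀⟩ := hcon
  set H : Set ℕ := {d | ∃ μ m, μ ∈ exponents J ∧ IsTopVar μ m ∧
    μ - Finsupp.single m 1 ∉ exponents J ∧ μ.degree = d} with hH
  have hbdd : BddAbove H := by
    refine ⟨n * (2 * maxGenDegree J), ?_⟩
    rintro _ ⟨μ, m, h1, h2, h3, rfl⟩
    exact hq.degree_le h1 h2 h3
  have hne : H.Nonempty := ⟨_, μ₀, m₀, hμ₀, hm₀, hμm₀, rfl⟩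
  obtain ⟨μ, m, h1, h2, h3, h4⟩ := Nat.sSup_mem hne hbdd
  have hlt : q < μ.degree := by
    rw [h4]
    exact hd₀.trans_le (le_csSup hbdd ⟨μ₀, m₀, hμ₀, hm₀, hμm₀, rfl⟩)
  have htor : TorNonzero J m μ.degree := by
    refine torNonzero_of_isTopVar hJ h1 h2 h3 fun l hl => ?_
    by_contra hnot
    have htop : IsTopVar (μ + Finsupp.single l 1) m := by
      refine ⟨by simp [h2.1], fun i hi => ?_⟩
      simp [h2.2 i hi, Finsupp.single_eq_of_ne (hl.trans hi).ne']
    have hmem : μ.degree + 1 ∈ H := by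
      refine ⟨μ + Finsupp.single l 1, m, isUpperSet_exponents J le_self_add h1, htop, ?_,
        by simp⟩
      rwa [tsub_add_eq_add_tsub (single_le_of_ne_zero h2.1)] at hnot
    have := le_csSup hbdd hmem
    omega
  have := (le_regularity htor).trans hreg
  exact absurd (Nat.cast_le.1 this) (not_le.2 hlt)

/-! ### Finiteness of the regularity -/

/-- Exterior multiplication by the `i`-th basis vector. -/
def koszulWedge (i : Fin n) (c : Finset (Fin n) → MvPolynomial (Fin n) k) :
    Finset (Fin n) → MvPolynomial (Fin n) k :=
  fun S => if i ∈ S then (-1) ^ (S.filter (· < i)).card * c (S.erase i) else 0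

/-- Exterior multiplication by the `i`-th basis vector is a homotopy between `0` and
multiplication by `X i`. -/
theorem koszulDifferential_koszulWedge (i : Fin n)
    {c : Finset (Fin n) → MvPolynomial (Fin n) k} (hc : koszulDifferential c = 0) :
    koszulDifferential (koszulWedge i c) = fun T => X i * c T := by
  funext T
  by_cases hi : i ∈ T
  · obtain ⟨T, hiT, rfl⟩ : ∃ T', i ∉ T' ∧ insert i T' = T :=
      ⟨T.erase i, Finset.notMem_erase i T, Finset.insert_erase hi⟩
    have h0 := congrFun hc T
    have hsplit : Tᶜ = insert i (insert i T)ᶜ := by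
      ext l
      simp only [Finset.mem_compl, Finset.mem_insert, not_or]
      by_cases h : l = i
      · simp [h, hiT]
      · simp [h]
    simp only [koszulDifferential, Pi.zero_apply] at h0 ⊢
    -- The cycle condition at `T`, with the summand of index `i` set apart, evaluates the remaining
    -- sum as a multiple of `X i * c (insert i T)`.
    rw [hsplit, Finset.sum_insert (by simp)] at h0
    have hsq : ((-1 : MvPolynomial (Fin n) k) ^ (T.filter (· < i)).card) *
        (-1) ^ (T.filter (· < i)).card = 1 := by
      rw [← mul_pow]; simp
    have hterm : ∀ l ∈ (insert i T)ᶜ,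
        (-1) ^ ((insert i T).filter (· < l)).card *
          (X l * koszulWedge i c (insert l (insert i T))) =
        -((-1) ^ (T.filter (· < i)).card * ((-1) ^ (T.filter (· < l)).card *
          (X l * c (insert l T)))) := by
      intro l hl
      simp only [Finset.mem_compl, Finset.mem_insert, not_or] at hl
      have h1 : insert l (insert i T) = insert i (insert l T) := Finset.insert_comm _ _ _
      have h2 : i ∉ insert l T := by simp [Ne.symm hl.1, hiT]
      have h3 := koszul_sign_swap (k := k) hiT hl.2 (Ne.symm hl.1)
      have h4 : ((insert i (insert l T)).filter (· < i)).card =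
          ((insert l T).filter (· < i)).card := by
        rw [card_filter_lt_insert h2]; simp
      simp only [koszulWedge, h1, Finset.mem_insert_self, if_true, Finset.erase_insert h2, h4]
      have hsq' : ((-1 : MvPolynomial (Fin n) k) ^ ((insert l T).filter (· < i)).card) *
          (-1) ^ ((insert l T).filter (· < i)).card = 1 := by
        rw [← mul_pow]; simp
      linear_combination (X l * c (insert l T) * (-1) ^ (T.filter (· < i)).card *
          (-1) ^ ((insert l T).filter (· < i)).card) * h3 -
        (X l * c (insert l T) * (-1) ^ ((insert i T).filter (· < l)).card *
          (-1) ^ ((insert l T).filter (· < i)).card) * hsq -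
        (X l * c (insert l T) * (-1) ^ (T.filter (· < i)).card *
          (-1) ^ (T.filter (· < l)).card) * hsq'
    rw [Finset.sum_congr rfl hterm, Finset.sum_neg_distrib, ← Finset.mul_sum]
    linear_combination (X i * c (insert i T)) * hsq - (-1) ^ (T.filter (· < i)).card * h0
  · simp only [koszulDifferential]
    rw [Finset.sum_eq_single i]
    · simp only [koszulWedge, Finset.mem_insert_self, if_true, Finset.erase_insert hi,
        card_filter_lt_insert hi, lt_irrefl, if_false, add_zero]
      have hsq : ((-1 : MvPolynomial (Fin n) k) ^ (T.filter (· < i)).card) *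
          (-1) ^ (T.filter (· < i)).card = 1 := by
        rw [← mul_pow]; simp
      linear_combination (X i * c T) * hsq
    · intro l _ hli
      simp [koszulWedge, Ne.symm hli, hi]
    · simp [hi]

end Koszul

section RegularityFinite

variable {k : Type*} [Field k] {n : ℕ} {J : Ideal (MvPolynomial (Fin n) k)}

theorem koszulDifferential_zero :
    koszulDifferential (0 : Finset (Fin n) → MvPolynomial (Fin n) k) = 0 := by
  funext T
  simp [koszulDifferential]

theorem koszulDifferential_add (b c : Finset (Fin n) → MvPolynomial (Fin n) k) :
    koszulDifferential (b + c) = koszulDifferential b + koszulDifferential c := by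
  funext T
  simp [koszulDifferential, mul_add, Finset.sum_add_distrib]

theorem koszulDifferential_smul (p : MvPolynomial (Fin n) k)
    (c : Finset (Fin n) → MvPolynomial (Fin n) k) :
    koszulDifferential (p • c) = p • koszulDifferential c := by
  funext T
  simp only [koszulDifferential, Pi.smul_apply, smul_eq_mul, Finset.mul_sum]
  exact Finset.sum_congr rfl fun l _ => by ring

/-- The cycles of the Koszul complex of `J`. -/
def koszulCycles (J : Ideal (MvPolynomial (Fin n) k)) :
    Submodule (MvPolynomial (Fin n) k) (Finset (Fin n) → MvPolynomial (Fin n) k) where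
  carrier := {c | (∀ S, c S ∈ J) ∧ koszulDifferential c = 0}
  zero_mem' := ⟨fun _ => J.zero_mem, koszulDifferential_zero⟩
  add_mem' hb hc := ⟨fun S => J.add_mem (hb.1 S) (hc.1 S), by
    rw [koszulDifferential_add, hb.2, hc.2, add_zero]⟩
  smul_mem' p c hc := ⟨fun S => J.mul_mem_left p (hc.1 S), by
    rw [koszulDifferential_smul, hc.2, smul_zero]⟩

theorem koszulWedge_mem {c : Finset (Fin n) → MvPolynomial (Fin n) k} (hc : ∀ S, c S ∈ J)
    (i : Fin n) (S : Finset (Fin n)) : koszulWedge i c S ∈ J := by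
  rw [koszulWedge]
  split_ifs
  · exact J.mul_mem_left _ (hc _)
  · exact J.zero_mem

/-- Every Koszul cycle is homologous to one of bounded degree. -/
theorem exists_koszulCycle_reduction (J : Ideal (MvPolynomial (Fin n) k)) :
    ∃ D : ℕ, ∀ c ∈ koszulCycles J, ∃ c₀ b : Finset (Fin n) → MvPolynomial (Fin n) k,
      (∀ S, (c₀ S).totalDegree ≤ D) ∧ (∀ S, b S ∈ J) ∧ c = c₀ + koszulDifferential b := by
  classical
  obtain ⟨G, hG⟩ := IsNoetherian.noetherian (koszulCycles J)
  set D := G.sup fun z => Finset.univ.sup fun S => (z S).totalDegree with hD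
  have hadd : ∀ c c', (∃ c₀ b : Finset (Fin n) → MvPolynomial (Fin n) k,
      (∀ S, (c₀ S).totalDegree ≤ D) ∧ (∀ S, b S ∈ J) ∧ c = c₀ + koszulDifferential b) →
      (∃ c₀ b : Finset (Fin n) → MvPolynomial (Fin n) k,
      (∀ S, (c₀ S).totalDegree ≤ D) ∧ (∀ S, b S ∈ J) ∧ c' = c₀ + koszulDifferential b) →
      ∃ c₀ b : Finset (Fin n) → MvPolynomial (Fin n) k,
      (∀ S, (c₀ S).totalDegree ≤ D) ∧ (∀ S, b S ∈ J) ∧ c + c' = c₀ + koszulDifferential b := by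
    rintro _ _ ⟨c₀, b, h1, h2, rfl⟩ ⟨c₀', b', h1', h2', rfl⟩
    exact ⟨c₀ + c₀', b + b',
      fun S => (totalDegree_add _ _).trans (max_le (h1 S) (h1' S)),
      fun S => J.add_mem (h2 S) (h2' S), by rw [koszulDifferential_add]; abel⟩
  have key : ∀ c ∈ Submodule.span (MvPolynomial (Fin n) k) (G : Set _),
      ∀ p : MvPolynomial (Fin n) k, ∃ c₀ b : Finset (Fin n) → MvPolynomial (Fin n) k,
      (∀ S, (c₀ S).totalDegree ≤ D) ∧ (∀ S, b S ∈ J) ∧ p • c = c₀ + koszulDifferential b := by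
    intro c hc
    induction hc using Submodule.span_induction with
    | mem z hz =>
      have hzc : z ∈ koszulCycles J := hG ▸ Submodule.subset_span hz
      intro p
      induction p using MvPolynomial.induction_on with
      | C a =>
        refine ⟨C a • z, 0, fun S => ?_, fun S => J.zero_mem, by
          rw [koszulDifferential_zero, add_zero]⟩
        refine (totalDegree_mul _ _).trans ?_
        rw [totalDegree_C, zero_add]
        exact (Finset.le_sup (f := fun S => (z S).totalDegree) (Finset.mem_univ S)).trans
          (Finset.le_sup (f := fun z : Finset (Fin n) → MvPolynomial (Fin n) k =>
            Finset.univ.sup fun S => (z S).totalDegree) hz)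
      | add p q hp hq => rw [add_smul]; exact hadd _ _ hp hq
      -- Multiples of a variable are boundaries by the homotopy, so only constant multiples of the
      -- generators survive, and these have degree at most `D`.
      | mul_X p i _ =>
        have hpz := (koszulCycles J).smul_mem p hzc
        refine ⟨0, koszulWedge i (p • z), fun S => by simp, koszulWedge_mem hpz.1 i, ?_⟩
        rw [koszulDifferential_koszulWedge i hpz.2, zero_add]
        funext S
        simp only [Pi.smul_apply, smul_eq_mul]
        ring
    | zero =>
      exact fun p => ⟨0, 0, fun S => by simp, fun S => J.zero_mem, by
        rw [koszulDifferential_zero]; simp⟩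
    | add c c' _ _ h h' => exact fun p => by rw [smul_add]; exact hadd _ _ (h p) (h' p)
    | smul r c _ h => exact fun p => by rw [smul_smul]; exact h (p * r)
  refine ⟨D, fun c hc => ?_⟩
  have := key c (hG ▸ hc) 1
  rwa [one_smul] at this

theorem homogeneousComponent_X_mul (l : Fin n) (p : MvPolynomial (Fin n) k) (d : ℕ) :
    homogeneousComponent (d + 1) (X l * p) = X l * homogeneousComponent d p := by
  ext μ
  rw [coeff_homogeneousComponent, coeff_X_mul', coeff_X_mul', coeff_homogeneousComponent]
  by_cases hl : l ∈ μ.support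
  · have := degree_sub_single (Finsupp.mem_support_iff.1 hl)
    simp only [hl, if_true]
    exact if_congr (by omega) rfl rfl
  · simp [hl]

/-- In degrees above `D`, taking homogeneous components of c = c₀ + ∂b kills c₀. Restricting `b` to
the right degree and to sets of size i + 1 then exhibits c as a boundary. -/
theorem regularity_lt_top (hJ : IsGradedIdeal J) : regularity J < ⊤ := by
  obtain ⟨D, hD⟩ := exists_koszulCycle_reduction J
  refine lt_of_le_of_lt (b := (D : ℕ∞)) ?_ (ENat.natCast_lt_top D)
  refine iSup_le fun i => iSup_le fun j => iSup_le fun ⟨c, hc, hhom, hcyc, hnb⟩ => ?_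
  by_contra hlt
  rw [Nat.cast_le, not_le] at hlt
  obtain ⟨c₀, b, hc₀, hb, hcb⟩ := hD c ⟨hc.1, hcyc⟩
  obtain ⟨j, rfl⟩ : ∃ j', j = j' + 1 := ⟨j - 1, by omega⟩
  refine hnb ⟨fun S => if S.card = i + 1 then homogeneousComponent j (b S) else 0,
    ⟨fun S => ?_, fun S hS => if_neg hS⟩, ?_⟩
  · dsimp only
    split_ifs
    · exact hJ _ (hb S) _
    · exact J.zero_mem
  · funext T
    by_cases hT : T.card = i
    · have h1 : c T = homogeneousComponent (j + 1) (koszulDifferential b T) := by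
        have h2 := homogeneousComponent_of_mem (m := j + 1) (hhom T)
        rw [if_pos rfl] at h2
        rw [← h2, hcb, Pi.add_apply, map_add,
          homogeneousComponent_eq_zero _ _ ((hc₀ T).trans_lt hlt), zero_add]
      rw [h1, koszulDifferential, koszulDifferential, map_sum]
      refine Finset.sum_congr rfl fun l hl => ?_
      have hcard : (insert l T).card = i + 1 := by
        rw [Finset.card_insert_of_notMem (Finset.mem_compl.1 hl), hT]
      rw [if_pos hcard, ← homogeneousComponent_X_mul]
      rcases neg_one_pow_eq_or (MvPolynomial (Fin n) k) (T.filter (· < l)).card with h | h <;>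
        simp [h]
    · rw [hc.2 T hT]
      refine Finset.sum_eq_zero fun l hl => ?_
      dsimp only
      rw [if_neg, mul_zero, mul_zero]
      rw [Finset.card_insert_of_notMem (Finset.mem_compl.1 hl)]
      omega

end RegularityFinite

/-! ### Generic linear forms -/

section Generic

variable {k : Type*} [Field k] {n : ℕ}

/-- The linear form with a given coefficient vector. -/
def linearForm (k : Type*) [Field k] (n : ℕ) : (Fin n → k) →ₗ[k] MvPolynomial (Fin n) k :=
  Fintype.linearCombination k X

theorem linearForm_apply (y : Fin n → k) : linearForm k n y = ∑ j, C (y j) * X j := by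
  simp [linearForm, Fintype.linearCombination_apply, smul_eq_C_mul]

theorem linearForm_single (i : Fin n) : linearForm k n (Pi.single i 1) = X i := by
  simp [linearForm, Fintype.linearCombination_apply_single]

/-- Multiplication by `l` is injective on the homogeneous elements of large degree modulo `K`. -/
def IsEventuallyRegular (K : Ideal (MvPolynomial (Fin n) k)) (l : MvPolynomial (Fin n) k) :
    Prop :=
  ∃ N, ∀ d, N ≤ d → ∀ g : MvPolynomial (Fin n) k, g.IsHomogeneous d → l * g ∈ K → g ∈ K

/-- The polynomials whose products with all terms of degree at least `N` lie in `K`. -/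
def tailColon (K : Ideal (MvPolynomial (Fin n) k)) (N : ℕ) : Ideal (MvPolynomial (Fin n) k) where
  carrier := {a | ∀ μ : Fin n →₀ ℕ, N ≤ μ.degree → monomial μ 1 * a ∈ K}
  zero_mem' _ _ := by simp
  add_mem' ha hb μ hμ := by rw [mul_add]; exact K.add_mem (ha μ hμ) (hb μ hμ)
  smul_mem' r a ha μ hμ := by
    rw [smul_eq_mul, mul_left_comm]; exact K.mul_mem_left r (ha μ hμ)

/-- The ideals `tailColon K N` increase with `N` and stabilise. If every x_i a lies in the stable
one, then a lies in the next one, which is the same. -/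
theorem exists_tailColon_saturated (K : Ideal (MvPolynomial (Fin n) k)) :
    ∃ N, ∀ a, (∀ i, X i * a ∈ tailColon K N) → a ∈ tailColon K N := by
  obtain ⟨N, hN⟩ := monotone_stabilizes_iff_noetherian.2
    (inferInstanceAs (IsNoetherianRing (MvPolynomial (Fin n) k)))
    ⟨tailColon K, fun N N' h a ha μ hμ => ha μ (h.trans hμ)⟩
  refine ⟨N, fun a ha => ?_⟩
  have h1 : tailColon K N = tailColon K (N + 1) := hN (N + 1) (Nat.le_succ N)
  rw [h1]
  intro μ hμ
  obtain ⟨i, hi⟩ := exists_isTopVar (μ := μ) (by rintro rfl; simp at hμ)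
  have h2 := ha i (μ - Finsupp.single i 1) (by have := degree_sub_single hi.1; omega)
  rwa [X, ← mul_assoc, monomial_mul, one_mul,
    tsub_add_cancel_of_le (single_le_of_ne_zero hi.1)] at h2

/-- Terms of degree at least `N` send the finitely many generators of `tailColon K N` into `K`; only
multipliers of bounded degree leave a remainder. For graded `K` this makes the two ideals agree in
large degrees. -/
theorem exists_tailColon_reduction (K : Ideal (MvPolynomial (Fin n) k)) (N : ℕ) :
    ∃ B : ℕ, ∀ a ∈ tailColon K N, ∃ g : MvPolynomial (Fin n) k,
      g.totalDegree ≤ B ∧ a - g ∈ K := by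
  obtain ⟨G, hG⟩ := IsNoetherian.noetherian (tailColon K N)
  have hadd : ∀ a b, (∃ g : MvPolynomial (Fin n) k, g.totalDegree ≤ N + G.sup totalDegree ∧
      a - g ∈ K) → (∃ g : MvPolynomial (Fin n) k, g.totalDegree ≤ N + G.sup totalDegree ∧
      b - g ∈ K) → ∃ g : MvPolynomial (Fin n) k, g.totalDegree ≤ N + G.sup totalDegree ∧
      a + b - g ∈ K := by
    rintro a b ⟨g, h1, h2⟩ ⟨g', h1', h2'⟩
    exact ⟨g + g', (totalDegree_add _ _).trans (max_le h1 h1'), by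
      rw [add_sub_add_comm]; exact K.add_mem h2 h2'⟩
  have key : ∀ a ∈ Submodule.span (MvPolynomial (Fin n) k) (G : Set _),
      ∀ p : MvPolynomial (Fin n) k, ∃ g : MvPolynomial (Fin n) k,
        g.totalDegree ≤ N + G.sup totalDegree ∧ p * a - g ∈ K := by
    intro a ha
    induction ha using Submodule.span_induction with
    | mem z hz =>
      have hzT : z ∈ tailColon K N := hG ▸ Submodule.subset_span hz
      intro p
      induction p using MvPolynomial.induction_on' with
      | monomial μ c =>
        rcases le_total N μ.degree with hμ | hμ
        · refine ⟨0, by simp, ?_⟩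
          have : monomial μ c * z = C c * (monomial μ 1 * z) := by
            rw [← mul_assoc, C_mul_monomial, mul_one]
          rw [sub_zero, this]
          exact K.mul_mem_left _ (hzT μ hμ)
        · refine ⟨monomial μ c * z, (totalDegree_mul _ _).trans
            (add_le_add ?_ (Finset.le_sup hz)), by simp⟩
          exact (totalDegree_monomial_le μ c).trans hμ
      | add p q hp hq => rw [add_mul]; exact hadd _ _ hp hq
    | zero => exact fun p => ⟨0, by simp, by simp⟩
    | add a b _ _ h h' => exact fun p => by rw [mul_add]; exact hadd _ _ (h p) (h' p)
    | smul r a _ h => exact fun p => by rw [smul_eq_mul, ← mul_assoc]; exact h (p * r)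
  refine ⟨N + G.sup totalDegree, fun a ha => ?_⟩
  have := key a (hG ▸ ha) 1
  rwa [one_mul] at this

/-- Linear forms outside finitely many proper subspaces are eventually regular. -/
theorem exists_finset_isEventuallyRegular {K : Ideal (MvPolynomial (Fin n) k)}
    (hK : IsGradedIdeal K) :
    ∃ F : Finset (Submodule k (Fin n → k)), ⊤ ∉ F ∧
      ∀ y, (∀ V ∈ F, y ∉ V) → IsEventuallyRegular K (linearForm k n y) := by
  classical
  obtain ⟨N, hN⟩ := exists_tailColon_saturated K
  obtain ⟨B, hB⟩ := exists_tailColon_reduction K N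
  set T := tailColon K N
  set R := MvPolynomial (Fin n) k
  have hfin := associatedPrimes.finite R (R ⧸ T)
  -- The subspaces consist of the linear forms lying in an associated prime of `R ⧸ T`. A prime
  -- containing every variable would be the annihilator of a class that saturation forces to be
  -- zero.
  refine ⟨hfin.toFinset.image fun p => (p.restrictScalars k).comap (linearForm k n), ?_, ?_⟩
  · intro htop
    obtain ⟨p, hp, hptop⟩ := Finset.mem_image.1 htop
    rw [Set.Finite.mem_toFinset, AssociatedPrimes.mem_iff, isAssociatedPrime_iff] at hp
    obtain ⟨hprime, x, hx⟩ := hp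
    obtain ⟨a, rfl⟩ := Ideal.Quotient.mk_surjective x
    have hX : ∀ i, X i * a ∈ T := by
      intro i
      have h1 : (Pi.single i 1 : Fin n → k) ∈ (p.restrictScalars k).comap (linearForm k n) := by
        rw [hptop]; trivial
      rw [Submodule.mem_comap, linearForm_single] at h1
      have h2 : X i ∈ p := h1
      rw [hx, Submodule.mem_colon_singleton, Submodule.mem_bot] at h2
      exact Ideal.Quotient.eq_zero_iff_mem.1 h2
    have ha := Ideal.Quotient.eq_zero_iff_mem.2 (hN a hX)
    refine hprime.ne_top ?_
    rw [hx, ha, Ideal.eq_top_iff_one, Submodule.mem_colon_singleton]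
    simp
  · intro y hy
    have hnzd : ∀ g, linearForm k n y * g ∈ T → g ∈ T := by
      intro g hg
      by_contra hgT
      have h1 : linearForm k n y ∈ {r : R | ∃ x : R ⧸ T, x ≠ 0 ∧ r • x = 0} :=
        ⟨Ideal.Quotient.mk T g, fun h => hgT (Ideal.Quotient.eq_zero_iff_mem.1 h),
          Ideal.Quotient.eq_zero_iff_mem.2 hg⟩
      rw [← biUnion_associatedPrimes_eq_zero_divisors] at h1
      obtain ⟨p, hp, hyp⟩ := Set.mem_iUnion₂.1 h1
      exact hy _ (Finset.mem_image.2 ⟨p, hfin.mem_toFinset.2 hp, rfl⟩) hyp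
    refine ⟨B + 1, fun d hd g hg hmem => ?_⟩
    obtain ⟨g₀, h1, h2⟩ := hB g (hnzd g fun μ _ => K.mul_mem_left _ hmem)
    have h3 := hK _ h2 d
    have h4 := homogeneousComponent_of_mem (m := d) hg
    rw [if_pos rfl] at h4
    rwa [map_sub, homogeneousComponent_eq_zero d g₀ (by omega), sub_zero, h4] at h3

theorem isGradedIdeal_sup {I K : Ideal (MvPolynomial (Fin n) k)} (hI : IsGradedIdeal I)
    (hK : IsGradedIdeal K) : IsGradedIdeal (I ⊔ K) := by
  intro p hp d
  obtain ⟨a, ha, b, hb, rfl⟩ := Submodule.mem_sup.1 hp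
  rw [map_add]
  exact Submodule.add_mem_sup (hI a ha d) (hK b hb d)

theorem homogeneousComponent_linearForm_mul (y : Fin n → k) (p : MvPolynomial (Fin n) k) (d : ℕ) :
    homogeneousComponent (d + 1) (linearForm k n y * p) =
      linearForm k n y * homogeneousComponent d p := by
  simp only [linearForm_apply, Finset.sum_mul, map_sum, mul_assoc, homogeneousComponent_C_mul,
    homogeneousComponent_X_mul]

theorem isGradedIdeal_span_linearForm (s : Set (Fin n → k)) :
    IsGradedIdeal (Ideal.span (linearForm k n '' s)) := by
  -- The extra factor `r` lets the span induction absorb scalar multiples.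
  have key : ∀ p ∈ Ideal.span (linearForm k n '' s), ∀ r d,
      homogeneousComponent d (r * p) ∈ Ideal.span (linearForm k n '' s) := by
    intro p hp
    induction hp using Submodule.span_induction with
    | mem x hx =>
      obtain ⟨y, hy, rfl⟩ := hx
      rintro r (_ | d)
      · have : homogeneousComponent 0 (r * linearForm k n y) = 0 := by
          rw [homogeneousComponent_zero, linearForm_apply, ← constantCoeff_eq]
          simp
        rw [this]
        exact Ideal.zero_mem _
      · rw [mul_comm, homogeneousComponent_linearForm_mul]
        exact Ideal.mul_mem_right _ _ (Ideal.subset_span ⟨y, hy, rfl⟩)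
    | zero => intro r d; rw [mul_zero, map_zero]; exact Ideal.zero_mem _
    | add a b _ _ ha hb =>
      intro r d; rw [mul_add, map_add]; exact Ideal.add_mem _ (ha r d) (hb r d)
    | smul t a _ ha => intro r d; rw [smul_eq_mul, ← mul_assoc]; exact ha (r * t) d
  intro p hp d
  have := key p hp 1 d
  rwa [one_mul] at this

/-- Over an infinite field there is a basis of linear forms, each of which is eventually regular
modulo `I` and the later ones. -/
theorem exists_eventuallyRegular_family [Infinite k] {I : Ideal (MvPolynomial (Fin n) k)}
    (hI : IsGradedIdeal I) (r : ℕ) (hr : r ≤ n) :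
    ∃ y : Fin n → Fin n → k, LinearIndepOn k y {l | n - r ≤ (l : ℕ)} ∧
      ∀ c : Fin n, n - r ≤ (c : ℕ) → IsEventuallyRegular
        (I ⊔ Ideal.span (linearForm k n '' (y '' Set.Ioi c))) (linearForm k n (y c)) := by
  classical
  induction r with
  | zero =>
    refine ⟨0, ?_, fun c hc => absurd c.2 (by omega)⟩
    convert! linearIndepOn_empty k _
    ext l
    simp
  | succ r ih =>
    obtain ⟨y, hy, hreg⟩ := ih (by omega)
    set c₀ : Fin n := ⟨n - (r + 1), by omega⟩ with hc₀
    obtain ⟨F, hF, hFy⟩ := exists_finset_isEventuallyRegular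
      (isGradedIdeal_sup hI (isGradedIdeal_span_linearForm (y '' Set.Ioi c₀)))
    have hspan : Submodule.span k (y '' Set.Ioi c₀) ≠ ⊤ := by
      intro h
      have h1 := finrank_span_finset_le_card (R := k) ((Finset.Ioi c₀).image y)
      rw [Set.finrank, Finset.coe_image, Finset.coe_Ioi, h, finrank_top,
        Module.finrank_fin_fun] at h1
      have h2 := h1.trans Finset.card_image_le
      rw [Fin.card_Ioi] at h2
      have := c₀.2
      omega
    -- A vector space over an infinite field is not a finite union of proper subspaces. Avoiding the
    -- span gives independence; avoiding `F` gives eventual regularity.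
    have hF' : ⊤ ∉ insert (Submodule.span k (y '' Set.Ioi c₀)) F := by
      rw [Finset.mem_insert, not_or]
      exact ⟨hspan.symm, hF⟩
    obtain ⟨v, hv⟩ := (Set.ne_univ_iff_exists_notMem _).1
      (Subspace.biUnion_ne_univ_of_top_notMem hF')
    have hv' : ∀ V ∈ insert (Submodule.span k (y '' Set.Ioi c₀)) F, v ∉ V :=
      fun V hV h => hv (Set.mem_iUnion₂.2 ⟨V, hV, h⟩)
    have himage : ∀ c, c₀ ≤ c → Function.update y c₀ v '' Set.Ioi c = y '' Set.Ioi c := by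
      intro c hc
      exact Set.image_congr fun l hl => Function.update_of_ne (hc.trans_lt hl).ne' _ _
    refine ⟨Function.update y c₀ v, ?_, fun c hc => ?_⟩
    · have hset : {l : Fin n | n - (r + 1) ≤ (l : ℕ)} = insert c₀ (Set.Ioi c₀) := by
        ext l
        simp only [Set.mem_ofPred_eq, Set.mem_insert_iff, Set.mem_Ioi, Fin.lt_def, Fin.ext_iff, hc₀]
        omega
      have hset' : {l : Fin n | n - r ≤ (l : ℕ)} = Set.Ioi c₀ := by
        ext l
        simp only [Set.mem_ofPred_eq, Set.mem_Ioi, Fin.lt_def, hc₀]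
        omega
      rw [hset]
      rw [hset'] at hy
      refine LinearIndepOn.insert ?_ ?_
      · exact hy.congr fun l hl => (Function.update_of_ne (ne_of_gt hl) _ _).symm
      · rw [himage _ le_rfl, Function.update_self]
        exact hv' _ (Finset.mem_insert_self _ _)
    · have hc' : c₀ ≤ c := hc
      rw [himage c hc']
      rcases hc'.lt_or_eq with h | rfl
      · rw [Function.update_of_ne h.ne']
        refine hreg c ?_
        have : n - (r + 1) < (c : ℕ) := h
        omega
      · rw [Function.update_self]
        exact hFy v fun V hV => hv' V (Finset.mem_insert_of_mem hV)

theorem coordChange_X (A : Matrix.GeneralLinearGroup (Fin n) k) (i : Fin n) :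
    coordChange A (X i) = linearForm k n ((A : Matrix (Fin n) (Fin n) k) i) := by
  rw [coordChange, aeval_X, linearForm_apply]

theorem transform_sup_span (A : Matrix.GeneralLinearGroup (Fin n) k)
    (I : Ideal (MvPolynomial (Fin n) k)) (s : Set (Fin n)) :
    transform A⁻¹ (I ⊔ Ideal.span (linearForm k n ''
        ((fun i => (A : Matrix (Fin n) (Fin n) k) i) '' s))) =
      transform A⁻¹ I ⊔ Ideal.span (X '' s) := by
  rw [transform, Ideal.map_sup, Ideal.map_span, transform]
  congr 2
  rw [Set.image_image, Set.image_image]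
  exact Set.image_congr fun i _ => by rw [← coordChange_X, coordChange_inv_apply]

/-- Over an infinite field, some coordinate change makes the variables eventually regular
modulo the ideal and the later variables. -/
theorem exists_transform_isEventuallyRegular [Infinite k]
    {I : Ideal (MvPolynomial (Fin n) k)} (hI : IsGradedIdeal I) :
    ∃ A : Matrix.GeneralLinearGroup (Fin n) k, ∀ c : Fin n,
      IsEventuallyRegular (transform A I ⊔ Ideal.span (X '' Set.Ioi c)) (X c) := by
  obtain ⟨y, hy, hreg⟩ := exists_eventuallyRegular_family hI n le_rfl
  have hli : LinearIndependent k y := by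
    rw [← linearIndepOn_univ_iff]
    convert! hy
    ext l
    simp
  have hunit : IsUnit (Matrix.of y) := by
    rw [← Matrix.linearIndependent_rows_iff_isUnit]
    exact hli
  obtain ⟨B, hB⟩ := hunit
  have hBy : ((B : Matrix (Fin n) (Fin n) k) : Fin n → Fin n → k) = y := hB
  -- The change by `B` sends the variables to the chosen linear forms, so its inverse turns these
  -- forms into variables.
  refine ⟨B⁻¹, fun c => ?_⟩
  obtain ⟨N, hN⟩ := hreg c (by simp)
  refine ⟨N, fun d hd g hg hmem => ?_⟩
  rw [← transform_sup_span, mem_transform_iff, inv_inv] at hmem ⊢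
  rw [map_mul, coordChange_X] at hmem
  rw [hBy] at hmem ⊢
  exact hN d hd _ (isHomogeneous_coordChange B hg) hmem

/-! ### Eventually regular variables and the degree reverse lexicographic order -/

theorem isGradedIdeal_span_X (s : Set (Fin n)) :
    IsGradedIdeal (Ideal.span (X '' s : Set (MvPolynomial (Fin n) k))) := by
  have : (X '' s : Set (MvPolynomial (Fin n) k)) =
      (fun μ => monomial μ (1 : k)) '' ((fun i => Finsupp.single i 1) '' s) := by
    rw [Set.image_image]
    rfl
  rw [this]
  exact (isMonomialIdeal_span _).isGradedIdeal

open scoped MonomialOrder in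
theorem degRevLex_lt_of_isTopVar {μ ν : Fin n →₀ ℕ} {c l : Fin n}
    (hdeg : ν.degree = μ.degree) (hμ : ∀ i, c < i → μ i = 0) (hl : c < l) (hν : ν l ≠ 0) :
    ν ≺[degRevLex n] μ := by
  rw [degRevLex_lt_iff]
  obtain ⟨i, hi⟩ := exists_isTopVar (μ := ν) (by rintro rfl; simp at hν)
  have hli : l ≤ i := by
    by_contra hlt
    exact hν (hi.2 l (not_le.1 hlt))
  have hci : c < i := hl.trans_le hli
  exact Or.inr ⟨hdeg, i, fun j hj => by rw [hμ j (hci.trans hj), hi.2 j hj], by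
    rw [hμ i hci]; exact Nat.pos_of_ne_zero hi.1⟩

/-- Let f ∈ `I` be homogeneous with leading exponent μ and largest variable x_c. In the reverse
lexicographic order every term of f is divisible by x_c or by a later variable, so f ≡ x_c g modulo
later variables. Regularity gives g ∈ `I` modulo later variables. Correcting g by terms in later
variables, which are smaller than μ / x_c, gives an element of `I` with leading exponent μ / x_c. -/
theorem shrinksFrom_of_isEventuallyRegular {I : Ideal (MvPolynomial (Fin n) k)}
    (hI : IsGradedIdeal I)
    (h : ∀ c : Fin n, IsEventuallyRegular (I ⊔ Ideal.span (X '' Set.Ioi c)) (X c)) :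
    ∃ q₀, ShrinksFrom (exponents (leadingIdeal (degRevLex n) I)) q₀ := by
  choose N hN using h
  refine ⟨Finset.univ.sup N, fun μ c hμ hc hdeg => ?_⟩
  obtain ⟨f, hf, hf0, hfh, hfd⟩ := exists_isHomogeneous_of_mem_exponents (degRevLex n) hI hμ
  set u := μ - Finsupp.single c 1 with hu
  have huμ : u + Finsupp.single c 1 = μ := tsub_add_cancel_of_le (single_le_of_ne_zero hc.1)
  have hudeg : u.degree + 1 = μ.degree := degree_sub_single hc.1
  have hutop : ∀ i, c < i → u i = 0 := fun i hi => by simp [hu, hc.2 i hi]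
  have hNc : N c ≤ u.degree := by
    have := Finset.le_sup (f := N) (Finset.mem_univ c)
    omega
  set g := divMonomial f (Finsupp.single c 1) with hg
  have hgcoeff : ∀ ν, coeff ν g = coeff (Finsupp.single c 1 + ν) f := fun ν => by
    rw [hg, coeff_divMonomial]
  have hgh : g.IsHomogeneous u.degree := by
    intro ν hν
    rw [hgcoeff] at hν
    have := hfh hν
    rw [map_add] at this
    simp only [Finsupp.weight_single, Pi.one_apply, smul_eq_mul, mul_one] at this
    omega
  have hsub : f - X c * g ∈ Ideal.span (X '' Set.Ioi c : Set (MvPolynomial (Fin n) k)) := by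
    have hmod : f - X c * g = modMonomial f (Finsupp.single c 1) :=
      sub_eq_of_eq_add' (divMonomial_add_modMonomial_single f c).symm
    rw [hmod, mem_ideal_span_X_image]
    intro ν hν
    by_contra! hcon
    rw [mem_support_iff] at hν
    by_cases hcν : Finsupp.single c 1 ≤ ν
    · exact hν (coeff_modMonomial_of_le f hcν)
    rw [coeff_modMonomial_of_not_le f hcν] at hν
    have hνc : ν c = 0 := by
      by_contra h0
      exact hcν (single_le_of_ne_zero h0)
    have hνle := (degRevLex n).le_degree (mem_support_iff.2 hν)
    have hνdeg : μ.degree = ν.degree :=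
      hfh.degree_eq_sum_deg_support (mem_support_iff.2 hν)
    rw [hfd] at hνle
    refine absurd hνle (not_le.2 ?_)
    rw [degRevLex_lt_iff]
    refine Or.inr ⟨hνdeg, c, fun j hj => ?_, ?_⟩
    · rw [hcon j hj, hc.2 j hj]
    · rw [hνc]; exact Nat.pos_of_ne_zero hc.1
  have hXg : X c * g ∈ I ⊔ Ideal.span (X '' Set.Ioi c : Set (MvPolynomial (Fin n) k)) := by
    have := Submodule.sub_mem_sup hf hsub
    rwa [sub_sub_cancel] at this
  obtain ⟨a, ha, b, hb, hab⟩ := Submodule.mem_sup.1 (hN c _ hNc g hgh hXg)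
  set a' := homogeneousComponent u.degree a with ha'
  set b' := homogeneousComponent u.degree b with hb'
  have hab' : a' = g - b' := by
    have h1 := homogeneousComponent_of_mem (m := u.degree) hgh
    rw [if_pos rfl, ← hab, map_add] at h1
    rw [← hab]
    exact eq_sub_of_add_eq h1
  have hb'mem : b' ∈ Ideal.span (X '' Set.Ioi c : Set (MvPolynomial (Fin n) k)) :=
    isGradedIdeal_span_X _ _ hb _
  rw [mem_ideal_span_X_image] at hb'mem
  have hua' : coeff u a' ≠ 0 := by
    have h1 : coeff u b' = 0 := by
      by_contra h0
      obtain ⟨i, hi, hne⟩ := hb'mem u (mem_support_iff.2 h0)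
      exact hne (hutop i hi)
    rw [hab', coeff_sub, h1, sub_zero, hgcoeff, add_comm, huμ, ← hfd]
    exact mem_support_iff.1 ((degRevLex n).degree_mem_support hf0)
  refine (mem_exponents_leadingIdeal _).2 ⟨a', hI a ha _, fun h0 => hua' (by simp [h0]), ?_⟩
  refine (degRevLex n).toSyn.injective
    (le_antisymm ?_ ((degRevLex n).le_degree (mem_support_iff.2 hua')))
  refine (degRevLex n).degree_le_iff.2 fun ν hν => ?_
  have hνdeg : u.degree = ν.degree :=
    (homogeneousComponent_isHomogeneous u.degree a).degree_eq_sum_deg_support hν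
  by_cases hνb : ν ∈ b'.support
  · obtain ⟨i, hi, hne⟩ := hb'mem ν hνb
    exact (degRevLex_lt_of_isTopVar hνdeg.symm hutop hi hne).le
  · have h1 : coeff ν g ≠ 0 := by
      rw [mem_support_iff, hab', coeff_sub, notMem_support_iff.1 hνb, sub_zero] at hν
      exact hν
    rw [hgcoeff] at h1
    have h2 := (degRevLex n).le_degree (mem_support_iff.2 h1)
    rw [hfd, ← huμ, add_comm u, map_add, map_add] at h2
    exact le_of_add_le_add_left h2

/-- Over an infinite field, some coordinate change makes the leading ideal shrink. -/
theorem exists_transform_shrinksFrom [Infinite k]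
    {I : Ideal (MvPolynomial (Fin n) k)} (hI : IsGradedIdeal I) :
    ∃ (A : Matrix.GeneralLinearGroup (Fin n) k) (q₀ : ℕ),
      ShrinksFrom (exponents (leadingIdeal (degRevLex n) (transform A I))) q₀ := by
  obtain ⟨A, hA⟩ := exists_transform_isEventuallyRegular hI
  exact ⟨A, shrinksFrom_of_isEventuallyRegular (hI.transform A) hA⟩

end Generic

/-! ### Quasi-stable position and maximality of the β-vectors -/

section Main

variable {k : Type*} [Field k] {n : ℕ} {I : Ideal (MvPolynomial (Fin n) k)}

theorem InQuasiStablePosition.betaVector_transform_le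
    (h : InQuasiStablePosition (degRevLex n) I) (hI : IsGradedIdeal I)
    (A : Matrix.GeneralLinearGroup (Fin n) k) {q : ℕ}
    (hq : regularity (leadingIdeal (degRevLex n) I) ≤ q) :
    toLex (betaVector (degRevLex n) (transform A I) q) ≤ toLex (betaVector (degRevLex n) I q) :=
  StablePosition.betaVector_transform_le _ hI A
    (IsQuasiStable.shrinksFrom h (isMonomialIdeal_leadingIdeal _ I) hq) le_rfl

theorem inQuasiStablePosition_of_betaVector_transform_le [Infinite k] (hI : IsGradedIdeal I)
    (h : ∀ (A : Matrix.GeneralLinearGroup (Fin n) k) (q : ℕ),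
      regularity (leadingIdeal (degRevLex n) I) ≤ q →
        toLex (betaVector (degRevLex n) (transform A I) q) ≤
          toLex (betaVector (degRevLex n) I q)) :
    InQuasiStablePosition (degRevLex n) I := by
  obtain ⟨A, q₁, hA⟩ := exists_transform_shrinksFrom hI
  have htop := regularity_lt_top (isMonomialIdeal_leadingIdeal (degRevLex n) I).isGradedIdeal
  obtain ⟨q₂, hq₂⟩ := ENat.ne_top_iff_exists.1 htop.ne
  have heq : ∀ q, max q₁ q₂ ≤ q → topCount (exponents (leadingIdeal (degRevLex n) I)) q =
      topCount (exponents (leadingIdeal (degRevLex n) (transform A I))) q := by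
    intro q hq
    have h1 := h A q (by rw [← hq₂]; exact_mod_cast (le_max_right _ _).trans hq)
    -- The first claim's argument for A·I, moved back to `I` by `A⁻¹`, gives the opposite
    -- inequality.
    have h2 := betaVector_transform_le (degRevLex n) (hI.transform A) A⁻¹ hA
      ((le_max_left _ _).trans hq)
    rw [transform_inv_transform] at h2
    exact toLex.injective (le_antisymm h2 h1)
  refine isQuasiStable_of_shrinksFrom (q₀ := max q₁ q₂)
    (shrinksFrom_of_sum_topCount_eq (isUpperSet_exponents _) fun q hq i => ?_)
  rw [heq q hq, heq (q + 1) (by omega)]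
  exact sum_topCount_eq (isUpperSet_exponents _) hA ((le_max_left _ _).trans hq) i

/-- The restriction to degrees with I_q ≠ 0 costs nothing: if I_q = 0, then (A·I)_q = 0 and its
β-vector is zero. -/
theorem InBetaMaximalPosition.betaVector_transform_le
    (h : InBetaMaximalPosition (degRevLex n) I) (hI : IsGradedIdeal I)
    (A : Matrix.GeneralLinearGroup (Fin n) k) (q : ℕ) :
    toLex (betaVector (degRevLex n) (transform A I) q) ≤
      toLex (betaVector (degRevLex n) I q) := by
  by_cases hq : ∃ f ∈ I, f ≠ 0 ∧ f.IsHomogeneous q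
  · exact h A q hq
  · refine (congrArg toLex (_root_.funext fun i => ?_ :
      betaVector (degRevLex n) (transform A I) q = 0)).trans_le
      (Pi.toLex_monotone fun _ => Nat.zero_le _)
    rw [betaVector_eq_topCount, topCount, Pi.zero_apply, Set.ncard_eq_zero (finite_degree_eq_and _ _),
      Set.eq_empty_iff_forall_notMem]
    rintro μ ⟨rfl, hμ, -⟩
    obtain ⟨f, hf, h0, hh, -⟩ :=
      exists_isHomogeneous_of_mem_exponents _ (hI.transform A) hμ
    refine hq ⟨coordChange A⁻¹ f, mem_transform_iff.1 hf, fun h => h0 ?_,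
      isHomogeneous_coordChange _ hh⟩
    rw [← coordChange_apply_inv A f, h, map_zero]

end Main

end StablePosition

end

theorem mainTheorem6 {k : Type*} [Field k] {n : ℕ} (I : Ideal (MvPolynomial (Fin n) k))
    (hI : I.IsHomogeneous (MvPolynomial.homogeneousSubmodule (Fin n) k)) :
    (InQuasiStablePosition (degRevLex n) I →
      ∀ (A : Matrix.GeneralLinearGroup (Fin n) k) (q : ℕ),
        regularity
            (leadingIdeal (degRevLex n) I) ≤ q →
          toLex (betaVector (degRevLex n)
              (transform A I) q) ≤
            toLex (betaVector (degRevLex n) I q)) ∧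
    (Infinite k →
      (InQuasiStablePosition (degRevLex n) I ↔
        ∀ (A : Matrix.GeneralLinearGroup (Fin n) k) (q : ℕ),
          regularity
              (leadingIdeal (degRevLex n) I) ≤ q →
            toLex (betaVector (degRevLex n)
                (transform A I) q) ≤
              toLex (betaVector (degRevLex n) I q)) ∧
      (InBetaMaximalPosition (degRevLex n) I →
        InQuasiStablePosition (degRevLex n) I)) := by
  have hI' : IsGradedIdeal I := fun p hp d =>
    MvPolynomial.homogeneousComponent_mem_of_mem hI hp d
  refine ⟨fun h A q hq => h.betaVector_transform_le hI' A hq, fun hk =>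
    ⟨⟨fun h A q hq => h.betaVector_transform_le hI' A hq,
      inQuasiStablePosition_of_betaVector_transform_le hI'⟩, fun h => ?_⟩⟩
  exact inQuasiStablePosition_of_betaVector_transform_le hI'
    fun A q _ => h.betaVector_transform_le hI' A q
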